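/- Conventions. Let $k$ be a skew field. A crossed product $k*G=k*_{c,\tau}G$ of $k$ with a group $G$ is given by maps $c\colon G\to\operatorname{Aut}(k)$ and $\tau\colon G\times G\to k^\times$ with $\tau(g,h)\,c_{gh}(r)=c_g(c_h(r))\,\tau(g,h)$ and $\tau(g,h)\,\tau(gh,l)=c_g(\tau(h,l))\,\tau(g,hl)$; it is the free left $k$-module on $G$ with $(a\,g)(b\,h)=a\,c_g(b)\,\tau(g,h)\,gh$. For a subgroup $K\le G$, $k*K\subseteq k*G$ is the crossed product of the restricted data. A ring $R$ is prime if $AB=0$ implies $A=0$ or $B=0$ for two-sided ideals $A,B$; it is left Goldie if the number of summands of direct sums of nonzero left ideals of $R$ is bounded and the left annihilators $\{r\mid rx=0\}$, $x\in R$, satisfy the ascending chain condition. $\Delta^+(G)$ is the subgroup generated by the finite normal subgroups of $G$. Modules are left modules. If $R$ is a prime left Goldie ring and $S$ its set of non-zero-divisors, then $S^{-1}R\cong\operatorname{Mat}_d(D)$ for some $d$ and some skew field $D$; for an $R$-module $M$ put $\dim^{\mathrm{Ore}}_R(M)=n/d\in[0,\infty]$, where $n\in\{0,1,\dots,\infty\}$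 is the number of irreducible summands (the length) of the $S^{-1}R$-module $S^{-1}R\otimes_R M$. **Theorem.** (1) Let $k*H$ be a crossed product with a group $H$ and let $K\trianglelefteq H$ be a normal subgroup of finite index such that $k*K$ is prime left Goldie and $k*H$ is prime. Then $k*H$ is left Goldie. If $S$ and $T$ denote the sets of non-zero-divisors of $k*K$ and of $k*H$, then $S$ and $T$ are left Ore sets in $k*H$ and there is a ring isomorphism $S^{-1}(k*H)\cong T^{-1}(k*H)$ compatible with the canonical maps from $k*H$. For every $k*H$-module $N$, $$\frac{\dim^{\mathrm{Ore}}_{k*K}(\operatorname{res} N)}{[H:K]}=\dim^{\mathrm{Ore}}_{k*H}(N).$$ (2) If $\Delta^+(H)=1$, $k*H$ is left Goldie and $K\trianglelefteq H$ has finite index, then $k*H$ is prime and $k*K$ is prime left Goldie; in particular the formula of (1) holds. (3) Let $k*G$ be a crossed product with a group $G$, and let $H,H'\le G$ be subgroups of finite index with $\Delta^+(H)=\Delta^+(H')=1$ such that $k*H$ and $k*H'$ are left Goldie. Then for every $k*G$-module $M$, $$\frac{\dim^{\mathrm{Ore}}_{k*H}(\operatorname{res}M)}{[G:H]}=\frac{\dim^{\mathrm{Ore}}_{k*H'}(\operatorname{res}M)}{[G:H']},$$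 i.e. the virtual Ore dimension $\operatorname{vdim}^{\mathrm{Ore}}_{k*G}(M)$ does not depend on the chosen finite-index subgroup. -/

import Mathlib

open scoped TensorProduct ENNReal nonZeroDivisors

universe u v w

/-! ### Crossed products -/

/-- The data `(c, τ)` of a crossed product `R *_{c,τ} G`: maps `c : G → Aut(R)` and
`τ : G × G → Rˣ` such that `c_g ∘ c_h = conj(τ(g,h)) ∘ c_{gh}` and
`τ(g,h) τ(gh,l) = c_g(τ(h,l)) τ(g,hl)`. No normalization is required. -/
structure CrossedSystem (R : Type*) (G : Type*) [Ring R] [Group G] where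
  act : G → (R ≃+* R)
  twist : G → G → Rˣ
  twist_mul_act : ∀ (g h : G) (r : R),
    (twist g h : R) * act (g * h) r = act g (act h r) * (twist g h : R)
  cocycle : ∀ g h l : G,
    (twist g h : R) * (twist (g * h) l : R) = act g (twist h l : R) * (twist g (h * l) : R)

namespace CrossedSystem

variable {R : Type*} {G : Type*} {G' : Type*} [Ring R] [Group G] [Group G']

theorem act_one (d : CrossedSystem R G) (r : R) :
    d.act 1 r = (d.twist 1 1 : R) * r * ((d.twist 1 1)⁻¹ : Rˣ) := by
  obtain ⟨s, rfl⟩ := (d.act 1).surjective r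
  have h := d.twist_mul_act 1 1 s
  rw [mul_one] at h
  rw [h, mul_assoc, Units.mul_inv, mul_one]

theorem twist_one_left (d : CrossedSystem R G) (g : G) : d.twist 1 g = d.twist 1 1 := by
  have h := d.cocycle 1 1 g
  simp only [one_mul, Units.mul_left_inj] at h
  rw [act_one, mul_assoc] at h
  have h2 : (1 : R) = (d.twist 1 g : R) * ((d.twist 1 1)⁻¹ : Rˣ) :=
    (d.twist 1 1).isUnit.mul_left_cancel (by rw [mul_one]; exact h)
  rw [Units.eq_mul_inv_iff_mul_eq, one_mul] at h2
  exact Units.ext h2.symm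

theorem twist_one_right (d : CrossedSystem R G) (g : G) :
    (d.twist g 1 : R) = d.act g (d.twist 1 1 : R) := by
  have h := d.cocycle g 1 1
  simpa only [mul_one, Units.mul_left_inj] using h

/-- The system obtained by pulling back along a group homomorphism. -/
def comap (d : CrossedSystem R G) (f : G' →* G) : CrossedSystem R G' where
  act g := d.act (f g)
  twist g h := d.twist (f g) (f h)
  twist_mul_act g h r := by rw [map_mul]; exact d.twist_mul_act _ _ r
  cocycle g h l := by rw [map_mul, map_mul]; exact d.cocycle _ _ _

/-- The system restricted to a subgroup `H`, which defines `R * H`. -/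
def restrict (d : CrossedSystem R G) (H : Subgroup G) : CrossedSystem R H := d.comap H.subtype

end CrossedSystem

namespace CrossedSystem

variable {R : Type*} {G : Type*} {G' : Type*} [Ring R] [Group G] [Group G']

/-- The product of two formal sums, determined by `(a g) (b h) = a c_g(b) τ(g,h) (gh)`. -/
noncomputable def mulCoeff (d : CrossedSystem R G) (x y : G →₀ R) : G →₀ R :=
  x.sum fun g a => y.sum fun h b =>
    Finsupp.single (g * h) (a * d.act g b * (d.twist g h : R))

/-- The unit `τ(1,1)⁻¹ 1`. -/
noncomputable def oneCoeff (d : CrossedSystem R G) : G →₀ R :=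
  Finsupp.single 1 (((d.twist 1 1)⁻¹ : Rˣ) : R)

theorem zero_mulCoeff (d : CrossedSystem R G) (x : G →₀ R) : d.mulCoeff 0 x = 0 :=
  Finsupp.sum_zero_index

theorem mulCoeff_zero (d : CrossedSystem R G) (x : G →₀ R) : d.mulCoeff x 0 = 0 := by
  simp [mulCoeff]

theorem add_mulCoeff (d : CrossedSystem R G) (x y z : G →₀ R) :
    d.mulCoeff (x + y) z = d.mulCoeff x z + d.mulCoeff y z := by
  unfold mulCoeff
  refine Finsupp.sum_add_index' (fun g => by simp) (fun g a b => ?_)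
  rw [← Finsupp.sum_add]
  simp only [add_mul, Finsupp.single_add]

theorem mulCoeff_add (d : CrossedSystem R G) (x y z : G →₀ R) :
    d.mulCoeff x (y + z) = d.mulCoeff x y + d.mulCoeff x z := by
  unfold mulCoeff
  rw [← Finsupp.sum_add]
  refine Finsupp.sum_congr fun g _ => ?_
  exact Finsupp.sum_add_index' (fun h => by simp)
    (fun h a b => by simp only [map_add, mul_add, add_mul, Finsupp.single_add])

theorem mulCoeff_single (d : CrossedSystem R G) (g h : G) (a b : R) :
    d.mulCoeff (Finsupp.single g a) (Finsupp.single h b)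
      = Finsupp.single (g * h) (a * d.act g b * (d.twist g h : R)) := by
  simp [mulCoeff]

theorem mulCoeff_assoc (d : CrossedSystem R G) (x y z : G →₀ R) :
    d.mulCoeff (d.mulCoeff x y) z = d.mulCoeff x (d.mulCoeff y z) := by
  induction x using Finsupp.induction_linear with
  | zero => simp only [zero_mulCoeff]
  | add x x' hx hx' => simp only [add_mulCoeff, hx, hx']
  | single g a =>
    induction y using Finsupp.induction_linear with
    | zero => simp only [zero_mulCoeff, mulCoeff_zero]
    | add y y' hy hy' => simp only [add_mulCoeff, mulCoeff_add, hy, hy']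
    | single h b =>
      induction z using Finsupp.induction_linear with
      | zero => simp only [mulCoeff_zero]
      | add z z' hz hz' => simp only [mulCoeff_add, hz, hz']
      | single l c =>
        simp only [mulCoeff_single, mul_assoc g h l]
        congr 1
        simp only [map_mul]
        calc a * d.act g b * (d.twist g h : R) * d.act (g * h) c * (d.twist (g * h) l : R)
            = a * d.act g b * ((d.twist g h : R) * d.act (g * h) c) * (d.twist (g * h) l : R) := by
              simp only [mul_assoc]
          _ = a * d.act g b * d.act g (d.act h c)
                * ((d.twist g h : R) * (d.twist (g * h) l : R)) := by
              rw [d.twist_mul_act]; simp only [mul_assoc]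
          _ = _ := by rw [d.cocycle]; simp only [mul_assoc]

theorem one_mulCoeff (d : CrossedSystem R G) (x : G →₀ R) : d.mulCoeff d.oneCoeff x = x := by
  induction x using Finsupp.induction_linear with
  | zero => exact d.mulCoeff_zero _
  | add x y hx hy => rw [mulCoeff_add, hx, hy]
  | single g a =>
    rw [oneCoeff, mulCoeff_single, d.act_one, d.twist_one_left g, one_mul]
    exact congrArg (Finsupp.single g) (by simp [mul_assoc])

theorem mulCoeff_one (d : CrossedSystem R G) (x : G →₀ R) : d.mulCoeff x d.oneCoeff = x := by
  induction x using Finsupp.induction_linear with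
  | zero => exact d.zero_mulCoeff _
  | add x y hx hy => rw [add_mulCoeff, hx, hy]
  | single g a =>
    rw [oneCoeff, mulCoeff_single, d.twist_one_right, mul_one, mul_assoc, ← map_mul,
      Units.inv_mul, map_one, mul_one]

theorem mapDomain_mulCoeff (d : CrossedSystem R G) (f : G' →* G) (x y : G' →₀ R) :
    Finsupp.mapDomain f ((d.comap f).mulCoeff x y)
      = d.mulCoeff (Finsupp.mapDomain f x) (Finsupp.mapDomain f y) := by
  induction x using Finsupp.induction_linear with
  | zero => simp only [zero_mulCoeff, Finsupp.mapDomain_zero]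
  | add x x' hx hx' => simp only [add_mulCoeff, Finsupp.mapDomain_add, hx, hx']
  | single g a =>
    induction y using Finsupp.induction_linear with
    | zero => simp only [mulCoeff_zero, Finsupp.mapDomain_zero]
    | add y y' hy hy' => simp only [mulCoeff_add, Finsupp.mapDomain_add, hy, hy']
    | single h b =>
      simp only [mulCoeff_single, Finsupp.mapDomain_single, map_mul]
      rfl

theorem mapDomain_oneCoeff (d : CrossedSystem R G) (f : G' →* G) :
    Finsupp.mapDomain f (d.comap f).oneCoeff = d.oneCoeff := by
  simp [oneCoeff, comap]

end CrossedSystem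

/-- The crossed product `R *_{c,τ} G`: the free left `R`-module with basis `G`, with the
multiplication determined by `(a g) (b h) = a c_g(b) τ(g,h) (gh)`. -/
@[ext]
structure CrossedProduct {R : Type*} {G : Type*} [Ring R] [Group G] (d : CrossedSystem R G) where
  coeff : G →₀ R

namespace CrossedProduct

variable {R : Type*} {G : Type*} {G' : Type*} [Ring R] [Group G] [Group G']

instance (d : CrossedSystem R G) : Zero (CrossedProduct d) := ⟨⟨0⟩⟩
noncomputable instance (d : CrossedSystem R G) : One (CrossedProduct d) := ⟨⟨d.oneCoeff⟩⟩
noncomputable instance (d : CrossedSystem R G) : Add (CrossedProduct d) :=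
  ⟨fun x y => ⟨x.coeff + y.coeff⟩⟩
noncomputable instance (d : CrossedSystem R G) : Neg (CrossedProduct d) :=
  ⟨fun x => ⟨-x.coeff⟩⟩
noncomputable instance (d : CrossedSystem R G) : Mul (CrossedProduct d) :=
  ⟨fun x y => ⟨d.mulCoeff x.coeff y.coeff⟩⟩

theorem coeff_zero (d : CrossedSystem R G) : (0 : CrossedProduct d).coeff = 0 := rfl
theorem coeff_one (d : CrossedSystem R G) : (1 : CrossedProduct d).coeff = d.oneCoeff := rfl
theorem coeff_add {d : CrossedSystem R G} (x y : CrossedProduct d) :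
    (x + y).coeff = x.coeff + y.coeff := rfl
theorem coeff_neg {d : CrossedSystem R G} (x : CrossedProduct d) : (-x).coeff = -x.coeff := rfl
theorem coeff_mul {d : CrossedSystem R G} (x y : CrossedProduct d) :
    (x * y).coeff = d.mulCoeff x.coeff y.coeff := rfl

noncomputable instance (d : CrossedSystem R G) : Ring (CrossedProduct d) where
  add_assoc _ _ _ := by ext1; simp only [coeff_add, add_assoc]
  zero_add _ := by ext1; simp only [coeff_add, coeff_zero, zero_add]
  add_zero _ := by ext1; simp only [coeff_add, coeff_zero, add_zero]
  add_comm _ _ := by ext1; simp only [coeff_add, add_comm]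
  neg_add_cancel _ := by ext1; simp only [coeff_add, coeff_neg, coeff_zero, neg_add_cancel]
  nsmul := nsmulRec
  zsmul := zsmulRec
  zero_mul _ := by ext1; simp only [coeff_mul, coeff_zero, d.zero_mulCoeff]
  mul_zero _ := by ext1; simp only [coeff_mul, coeff_zero, d.mulCoeff_zero]
  left_distrib _ _ _ := by ext1; simp only [coeff_mul, coeff_add, d.mulCoeff_add]
  right_distrib _ _ _ := by ext1; simp only [coeff_mul, coeff_add, d.add_mulCoeff]
  mul_assoc _ _ _ := by ext1; simp only [coeff_mul, d.mulCoeff_assoc]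
  one_mul _ := by ext1; simp only [coeff_mul, coeff_one, d.one_mulCoeff]
  mul_one _ := by ext1; simp only [coeff_mul, coeff_one, d.mulCoeff_one]

/-- The ring homomorphism `R * G' → R * G`, `a g ↦ a f(g)`, induced by a group homomorphism `f`. -/
noncomputable def map (d : CrossedSystem R G) (f : G' →* G) :
    CrossedProduct (d.comap f) →+* CrossedProduct d where
  toFun x := ⟨Finsupp.mapDomain f x.coeff⟩
  map_zero' := by ext1; exact Finsupp.mapDomain_zero (f := f)
  map_one' := by ext1; exact d.mapDomain_oneCoeff f
  map_add' _ _ := by ext1; exact Finsupp.mapDomain_add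
  map_mul' _ _ := by ext1; exact d.mapDomain_mulCoeff f _ _

/-- The inclusion `R * H → R * G` for a subgroup `H` of `G`. -/
noncomputable def incl (d : CrossedSystem R G) (H : Subgroup G) :
    CrossedProduct (d.restrict H) →+* CrossedProduct d :=
  map d H.subtype

end CrossedProduct

/-! ### Prime rings, left Goldie rings, `Δ⁺` -/

/-- `R` is prime: `A B = 0` implies `A = 0` or `B = 0` for two-sided ideals `A, B`. -/
def IsPrimeRing (R : Type*) [Ring R] : Prop :=
  ∀ A B : TwoSidedIdeal R, (∀ a ∈ A, ∀ b ∈ B, a * b = 0) → A = ⊥ ∨ B = ⊥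

/-- The left annihilator `a(x) = {r | r x = 0}`. -/
def leftAnnihilator {R : Type*} [Ring R] (x : R) : Ideal R where
  carrier := {r | r * x = 0}
  add_mem' {a b} ha hb := by
    simp only [Set.mem_ofPred_eq] at ha hb ⊢
    rw [add_mul, ha, hb, add_zero]
  zero_mem' := zero_mul x
  smul_mem' c r hr := by
    simp only [Set.mem_ofPred_eq, smul_eq_mul] at hr ⊢
    rw [mul_assoc, hr, mul_zero]

/-- `R` is left Goldie: the number of summands in direct sums of nonzero left ideals of `R` is
bounded, and the left annihilators of elements satisfy the ascending chain condition. -/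
def IsLeftGoldie (R : Type*) [Ring R] : Prop :=
  (∃ d : ℕ, ∀ (n : ℕ) (I : Fin n → Ideal R), (∀ i, I i ≠ ⊥) → iSupIndep I → n ≤ d) ∧
  (∀ x : ℕ → R, Monotone (fun n => leftAnnihilator (x n)) →
    ∃ n, ∀ m, n ≤ m → leftAnnihilator (x m) = leftAnnihilator (x n))

/-- `Δ⁺(G)`, the subgroup generated by the finite normal subgroups of `G`. -/
def deltaPlus (G : Type*) [Group G] : Subgroup G :=
  sSup {N : Subgroup G | N.Normal ∧ Finite N}

/-! ### Ore dimension -/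

/-- The left `Q`-module `Q ⊗_R M`, for a homomorphism `f : R → Q` of (noncommutative) rings and a
left `R`-module `M`: the quotient of `Q ⊗_ℤ M` by the relations `q r ⊗ m = q ⊗ r m`. -/
abbrev BaseChange {R Q : Type*} [Ring R] [Ring Q] (f : R →+* Q) (M : Type*) [AddCommGroup M]
    [Module R M] :=
  (Q ⊗[ℤ] M) ⧸ Submodule.span Q
    {x : Q ⊗[ℤ] M | ∃ (q : Q) (r : R) (m : M), x = (q * f r) ⊗ₜ[ℤ] m - q ⊗ₜ[ℤ] (r • m)}

/-- `n / d`, where `n` is the length of `Q ⊗_R M` and `d` is the length of `Q` as left `Q`-modules,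
for `Q = S⁻¹R` the Ore localization at the set `S` of non-zero-divisors. If `Q ≅ Mat_d(D)` for a
skew field `D`, this `d` is the size of the matrices, and the length of a `Q`-module is the
number of its irreducible summands (`∞` if there are infinitely many). -/
noncomputable def oreDimOfOreSet (R : Type*) [Ring R] [OreLocalization.OreSet R⁰] (M : Type*)
    [AddCommGroup M] [Module R M] : ℝ≥0∞ :=
  ((Module.length (OreLocalization R⁰ R)
      (BaseChange (OreLocalization.numeratorRingHom (R := R) (S := R⁰)) M) : ℕ∞) : ℝ≥0∞) /
    ((Module.length (OreLocalization R⁰ R) (OreLocalization R⁰ R) : ℕ∞) : ℝ≥0∞)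

open Classical in
/-- The Ore dimension `dim^Ore_R(M)` of a left module `M` over a prime left Goldie ring `R` (whose
non-zero-divisors satisfy the left Ore condition; the value `0` in the other case is junk). -/
noncomputable def oreDim (R : Type*) [Ring R] (M : Type*) [AddCommGroup M] [Module R M] : ℝ≥0∞ :=
  if h : Nonempty (OreLocalization.OreSet R⁰) then
    letI := Classical.choice h
    oreDimOfOreSet R M
  else 0

/-- `dim^Ore_R(res M)`, for the restriction `res M` of an `S`-module `M` along `f : R →+* S`. -/
noncomputable def oreDimRes {R S : Type*} [Ring R] [Ring S] (f : R →+* S) (M : Type*)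
    [AddCommGroup M] [Module S M] : ℝ≥0∞ :=
  letI : Module R M := Module.compHom M f
  oreDim R M

/-- The virtual Ore dimension of an `R * G`-module `M`, computed through the finite-index
subgroup `H`: `dim^Ore_{R * H}(res M) / [G : H]`. -/
noncomputable def virtualOreDim {R : Type*} {G : Type*} [Ring R] [Group G] (d : CrossedSystem R G)
    (H : Subgroup G) (M : Type*) [AddCommGroup M] [Module (CrossedProduct d) M] : ℝ≥0∞ :=
  oreDimRes (CrossedProduct.incl d H) M / (H.index : ℝ≥0∞)

/-! ### Prime rings -/

/-! Over a prime left Goldie ring `R`, Goldie's theorem makes the non-zero-divisors left Ore and the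
fraction ring `Q` semisimple. The proof: `R` is left nonsingular, so elements with zero left
annihilator are regular, and every essential left ideal contains a regular element.

For (1), coset representatives give units of `R' = k*H` that normalize `R = k*K` and form a basis
over it (`IsNormalizingBasis`). Conjugation by them preserves regularity, so `S` is left Ore in
`R'`, and `Q' = S⁻¹R'` is free over `Q` of rank `[H:K]`, hence Artinian. A regular element of `R'`
acts on `Q'` by an injective right multiplication, which is therefore bijective; so `Q'` already
inverts `T`. If `R'` is prime, then `Q'` is prime Artinian with a single simple module `L`, and the
`Q`-length of a `Q'`-module is its `Q'`-length times the `Q`-length of `L`. Applying this to `S⁻¹N`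
and to `Q'` itself and dividing cancels `L` and leaves the factor `[H:K]`.

For (2), left ideals and annihilators of `k*K` extend faithfully to `k*H`, so the Goldie property
descends. Primeness follows Passman's method: if `Δ⁺(H) = 1`, then Dietzmann's lemma and Schur's
theorem show that the FC-centre is torsion-free abelian, so its finite subsets have unique products.
Given `x r b = 0` for all `r`, a minimal-support argument and B. H. Neumann's covering lemma turn
this into a vanishing product whose left factor is supported on the FC-centre, contradicting unique
products. The condition on the FC-centre passes to subgroups of finite index, so `k*K` is prime as
well.

For (3), both dimensions are compared with the one over the normal core of `H ⊓ H'`. -/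

/-- The right annihilator `B` of `aR` and the set `A` of all `x` with `xRB = 0` are two-sided ideals
with `AB = 0`, and they contain `b` and `a`. -/
theorem IsPrimeRing.eq_zero_or_eq_zero {R : Type*} [Ring R] (hR : IsPrimeRing R) {a b : R}
    (h : ∀ r, a * r * b = 0) : a = 0 ∨ b = 0 := by
  let B : TwoSidedIdeal R := .mk' {y | ∀ r, a * r * y = 0} (by simp)
    (fun hx hy r => by rw [mul_add, hx r, hy r, add_zero]) (fun hx r => by rw [mul_neg, hx r, neg_zero])
    (fun {x y} hy r => by rw [← mul_assoc, mul_assoc a, hy (r * x)])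
    (fun {x y} hx r => by rw [← mul_assoc, hx r, zero_mul])
  have hB : ∀ y, y ∈ B ↔ ∀ r, a * r * y = 0 := fun y => TwoSidedIdeal.mem_mk' ..
  let A : TwoSidedIdeal R := .mk' {x | ∀ r, ∀ y ∈ B, x * r * y = 0} (by simp)
    (fun hx hy r z hz => by rw [add_mul, add_mul, hx r z hz, hy r z hz, add_zero])
    (fun hx r z hz => by rw [neg_mul, neg_mul, hx r z hz, neg_zero])
    (fun {x y} hy r z hz => by rw [mul_assoc x, mul_assoc x, hy r z hz, mul_zero])
    (fun {x y} hx r z hz => by rw [mul_assoc x, hx _ z hz])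
  have hA : ∀ y, y ∈ A ↔ ∀ r, ∀ z ∈ B, y * r * z = 0 := fun y => TwoSidedIdeal.mem_mk' ..
  have haA : a ∈ A := (hA a).2 fun r y hy => (hB y).1 hy r
  have hbB : b ∈ B := (hB b).2 h
  refine (hR A B fun x hx y hy => by simpa using (hA x).1 hx 1 y hy).imp ?_ ?_
  · intro h0; rwa [h0, TwoSidedIdeal.mem_bot] at haA
  · intro h0; rwa [h0, TwoSidedIdeal.mem_bot] at hbB

theorem isPrimeRing_of_forall {R : Type*} [Ring R]
    (h : ∀ a b : R, (∀ r, a * r * b = 0) → a = 0 ∨ b = 0) : IsPrimeRing R := by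
  intro A B hAB
  by_contra! hne
  obtain ⟨a, ha, ha0⟩ : ∃ a ∈ A, a ≠ 0 := by
    by_contra! h0
    exact hne.1 (le_bot_iff.1 fun x hx => by rw [h0 x hx]; exact zero_mem _)
  obtain ⟨b, hb, hb0⟩ : ∃ b ∈ B, b ≠ 0 := by
    by_contra! h0
    exact hne.2 (le_bot_iff.1 fun x hx => by rw [h0 x hx]; exact zero_mem _)
  rcases h a b fun r => hAB _ (A.mul_mem_right _ _ ha) _ hb with h | h
  exacts [ha0 h, hb0 h]

/-! ### Goldie's theorem for prime rings -/

section Goldie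

variable {R : Type*} [Ring R]

theorem mem_leftAnnihilator {x r : R} : r ∈ leftAnnihilator x ↔ r * x = 0 := Iff.rfl

/-- A sequence of submodules that are successively disjoint from a decreasing chain of
"remainders" is independent. -/
theorem iSupIndep_of_antitone_of_disjoint {M : Type*} [AddCommGroup M] [Module R M]
    (V I : ℕ → Submodule R M) (hV : Antitone V) (hI : ∀ i, I i ≤ V i)
    (hd : ∀ i, Disjoint (I i) (V (i + 1))) (n : ℕ) : iSupIndep fun i : Fin n => I i := by
  classical
  rw [iSupIndep_iff_finsetSum_eq_zero_imp_eq_zero]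
  intro s v hv hs
  by_contra! hne
  obtain ⟨i₀, hi₀, hne⟩ := hne
  have hex : ∃ m, ∃ i ∈ s, (i : ℕ) = m ∧ v i ≠ 0 := ⟨i₀, i₀, hi₀, rfl, hne⟩
  obtain ⟨i, hi, hm, hvi⟩ := Nat.find_spec hex
  have hmin : ∀ j ∈ s, (j : ℕ) < i → v j = 0 := fun j hj hji => by
    by_contra h0
    exact Nat.find_min hex (hm ▸ hji) ⟨j, hj, rfl, h0⟩
  apply hvi
  refine Submodule.disjoint_def.1 (hd i) _ (hv i hi) ?_
  rw [← Finset.add_sum_erase _ _ hi, add_eq_zero_iff_eq_neg] at hs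
  rw [hs]
  refine neg_mem (Submodule.sum_mem _ fun j hj => ?_)
  obtain ⟨hji, hj⟩ := Finset.mem_erase.1 hj
  rcases lt_or_gt_of_ne (fun h => hji (Fin.ext h) : (j : ℕ) ≠ i) with h | h
  · rw [hmin j hj h]; exact zero_mem _
  · exact hV h (hI j (hv j hj))

theorem IsLeftGoldie.exists_eq_bot (hR : IsLeftGoldie R) (V I : ℕ → Ideal R) (hV : Antitone V)
    (hI : ∀ i, I i ≤ V i) (hd : ∀ i, Disjoint (I i) (V (i + 1))) : ∃ i, I i = ⊥ := by
  by_contra! h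
  obtain ⟨d, hd'⟩ := hR.1
  have := hd' (d + 1) (fun i => I i) (fun i => h i) (iSupIndep_of_antitone_of_disjoint V I hV hI hd _)
  omega

theorem IsLeftGoldie.wellFounded (hR : IsLeftGoldie R) :
    WellFounded fun x y : R => leftAnnihilator y < leftAnnihilator x := by
  rw [wellFounded_iff_isEmpty_descending_chain]
  refine ⟨fun ⟨x, hx⟩ => ?_⟩
  obtain ⟨n, hn⟩ := hR.2 x (monotone_nat_of_le_succ fun n => (hx n).le)
  exact (hx n).ne (hn (n + 1) n.le_succ).symm

/-- In a set of elements of a left Goldie ring, some left annihilator is maximal. -/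
theorem IsLeftGoldie.exists_maximal (hR : IsLeftGoldie R) (P : R → Prop) (hP : ∃ x, P x) :
    ∃ x, P x ∧ ∀ y, P y → leftAnnihilator x ≤ leftAnnihilator y →
      leftAnnihilator y ≤ leftAnnihilator x := by
  obtain ⟨x, hx, hmin⟩ := hR.wellFounded.has_min {x | P x} hP
  refine ⟨x, hx, fun y hy hxy => ?_⟩
  by_contra h
  exact hmin y hy (lt_of_le_not_ge hxy h)

/-- A left ideal is essential if it meets every principal left ideal `R x ≠ 0`. -/
def Ideal.IsEssential (E : Ideal R) : Prop := ∀ x : R, x ≠ 0 → ∃ r, r * x ∈ E ∧ r * x ≠ 0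

/-- If `x a = 0`, then `x` itself lies in the preimage of `E` under right multiplication by `a`;
otherwise essentiality of `E` is applied to `x a`. -/
theorem Ideal.IsEssential.colon {E : Ideal R} (hE : E.IsEssential) (a : R) {F : Ideal R}
    (hF : ∀ r, r * a ∈ E → r ∈ F) : F.IsEssential := by
  intro x hx
  by_cases hxa : x * a = 0
  · exact ⟨1, hF _ (by rw [one_mul, hxa]; exact E.zero_mem), by simpa⟩
  · obtain ⟨r, hr, hr0⟩ := hE _ hxa
    refine ⟨r, hF _ (by rwa [mul_assoc]), fun h => hr0 ?_⟩
    rw [← mul_assoc, h, zero_mul]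

theorem Ideal.IsEssential.mono {E F : Ideal R} (hE : E.IsEssential) (h : E ≤ F) :
    F.IsEssential := fun x hx => (hE x hx).imp fun _ hr => ⟨h hr.1, hr.2⟩

/-- A prime left Goldie ring is left nonsingular. -/
theorem IsLeftGoldie.eq_zero_of_isEssential (hR : IsLeftGoldie R) (hp : IsPrimeRing R) {x : R}
    (hx : (leftAnnihilator x).IsEssential) : x = 0 := by
  by_contra hx0
  obtain ⟨z, ⟨hz, hz0⟩, hmax⟩ :=
    hR.exists_maximal (fun x => (leftAnnihilator x).IsEssential ∧ x ≠ 0) ⟨x, hx, hx0⟩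
  refine hz0 ((hp.eq_zero_or_eq_zero (a := z) (b := z) fun r => ?_).elim id id)
  have hrz : (leftAnnihilator (r * z)).IsEssential := by
    refine hz.colon r fun s hs => ?_
    rw [mem_leftAnnihilator, mul_assoc] at hs
    exact hs
  rw [mul_assoc]
  by_contra h
  have hess : (leftAnnihilator (z * (r * z))).IsEssential := hrz.colon z fun s hs => by
    rw [mem_leftAnnihilator, mul_assoc] at hs
    exact hs
  -- Here `s` annihilates `z r z` but not `z`, so `z r z` would have a strictly larger annihilator
  -- than `z`.
  obtain ⟨s, hs, hs0⟩ := hrz z hz0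
  have := hmax _ ⟨hess, h⟩ (fun t ht => by
    rw [mem_leftAnnihilator] at ht ⊢; rw [← mul_assoc, ht, zero_mul]) (x := s) (by
    rw [mem_leftAnnihilator, ← mul_assoc]; exact hs)
  exact hs0 this

/-- If `l(x) = 0` then `R x` is essential. -/
theorem IsLeftGoldie.isEssential_span (hR : IsLeftGoldie R) {x : R}
    (hx : ∀ r, r * x = 0 → r = 0) : (Ideal.span {x}).IsEssential := by
  intro y hy
  by_contra! h
  have hpow : ∀ i, ∀ r, r * x ^ i = 0 → r = 0 := by
    intro i
    induction i with
    | zero => simp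
    | succ i ih => intro r hr; rw [pow_succ, ← mul_assoc] at hr; exact ih _ (hx _ hr)
  -- If `Rx ∩ Ry = 0`, the left ideals `R y xⁱ` form an infinite direct sum, with remainders `R xⁱ`.
  obtain ⟨i, hi⟩ := hR.exists_eq_bot (fun i => Ideal.span {x ^ i})
    (fun i => Ideal.span {y * x ^ i})
    (antitone_nat_of_succ_le fun i => by
      rw [Ideal.span_singleton_le_iff_mem, pow_succ', Ideal.mem_span_singleton']
      exact ⟨x, rfl⟩)
    (fun i => by
      rw [Ideal.span_singleton_le_iff_mem, Ideal.mem_span_singleton']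
      exact ⟨y, rfl⟩)
    (fun i => by
      rw [Submodule.disjoint_def]
      intro z hz hz'
      obtain ⟨a, rfl⟩ := Ideal.mem_span_singleton'.1 hz
      obtain ⟨b, hb⟩ := Ideal.mem_span_singleton'.1 hz'
      have : a * y - b * x = 0 := hpow i _ (by
        rw [sub_mul, mul_assoc, ← hb, pow_succ', ← mul_assoc, sub_self])
      rw [← mul_assoc, h a (Ideal.mem_span_singleton'.2 ⟨b, (sub_eq_zero.1 this).symm⟩), zero_mul])
  rw [Ideal.span_singleton_eq_bot] at hi
  exact hy (hpow i y hi)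

/-- If `x y = 0`, the annihilator of `y` contains the essential left ideal `Rx`, so `y = 0` by
nonsingularity. -/
theorem IsLeftGoldie.mem_nonZeroDivisors (hR : IsLeftGoldie R) (hp : IsPrimeRing R) {x : R}
    (hx : ∀ r, r * x = 0 → r = 0) : x ∈ R⁰ := by
  refine mem_nonZeroDivisors_iff.2 ⟨fun y hy => ?_, hx⟩
  refine hR.eq_zero_of_isEssential hp ((hR.isEssential_span hx).mono ?_)
  rw [Ideal.span_singleton_le_iff_mem, mem_leftAnnihilator, hy]

/-- Every nonzero left ideal contains some `v ≠ 0` with `l(v) ∩ R v = 0`. -/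
theorem IsLeftGoldie.exists_mem_ne_zero (hR : IsLeftGoldie R) (hp : IsPrimeRing R) (I : Ideal R)
    (hI : I ≠ ⊥) : ∃ v ∈ I, v ≠ 0 ∧ ∀ r, r * v * v = 0 → r * v = 0 := by
  obtain ⟨u₀, hu₀, hu₀'⟩ := Submodule.exists_mem_ne_zero_of_ne_bot hI
  obtain ⟨u, ⟨hu, hu0⟩, hmax⟩ := hR.exists_maximal (fun x => x ∈ I ∧ x ≠ 0) ⟨u₀, hu₀, hu₀'⟩
  obtain ⟨r, hr⟩ : ∃ r, u * r * u ≠ 0 := by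
    by_contra! h
    exact hu0 ((hp.eq_zero_or_eq_zero h).elim id id)
  -- By maximality `u r u` and `u` have the same left annihilator, which is the required property of
  -- `v = r u`.
  refine ⟨r * u, I.mul_mem_left _ hu, fun h => hr (by rw [mul_assoc, h, mul_zero]), fun y hy => ?_⟩
  have := hmax _ ⟨I.mul_mem_left (u * r) hu, hr⟩ (fun t ht => by
    rw [mem_leftAnnihilator] at ht ⊢; rw [← mul_assoc, ← mul_assoc, ht, zero_mul, zero_mul])
    (x := y * r) (by rw [mem_leftAnnihilator]; simpa only [mul_assoc] using hy)
  rw [← mul_assoc]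
  exact this

/-- **Goldie**: an essential left ideal of a prime left Goldie ring contains a non-zero-divisor. -/
theorem IsLeftGoldie.exists_mem_nonZeroDivisors (hR : IsLeftGoldie R) (hp : IsPrimeRing R)
    {E : Ideal R} (hE : E.IsEssential) : ∃ s ∈ E, s ∈ R⁰ := by
  by_contra! hno
  -- Starting from `a₀ = 0`, put `aₙ₊₁ = aₙ + vₙ` with `0 ≠ vₙ ∈ l(aₙ) ∩ E`; such a `vₙ` exists
  -- because otherwise `l(aₙ) = 0` and `aₙ ∈ E` is regular. The invariant `l(a) ∩ Ra = 0` gives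
  -- `l(aₙ₊₁) = l(aₙ) ∩ l(vₙ)`, so the left ideals `R vₙ` are independent.
  let P := {a : R // a ∈ E ∧ ∀ r, r * a * a = 0 → r * a = 0}
  have step : ∀ a : P, ∃ v, v ∈ leftAnnihilator a.1 ⊓ E ∧ v ≠ 0 ∧
      ∀ r, r * v * v = 0 → r * v = 0 := by
    intro a
    refine hR.exists_mem_ne_zero hp _ fun hbot => hno a.1 a.2.1 (hR.mem_nonZeroDivisors hp ?_)
    intro x hx
    by_contra hx0
    obtain ⟨r, hr, hr0⟩ := hE x hx0
    have : r * x ∈ leftAnnihilator a.1 ⊓ E :=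
      ⟨show r * x * a.1 = 0 by rw [mul_assoc, hx, mul_zero], hr⟩
    rw [hbot] at this
    exact hr0 this
  choose v hv hv0 hvv using step
  have key : ∀ (a : P) (r : R), r * (a.1 + v a) = 0 → r * a.1 = 0 ∧ r * v a = 0 := by
    intro a r hr
    have hva : v a * a.1 = 0 := (hv a).1
    rw [mul_add] at hr
    have h1 : r * a.1 = 0 := by
      refine a.2.2 r ?_
      rw [eq_neg_of_add_eq_zero_left hr, neg_mul, mul_assoc, hva, mul_zero, neg_zero]
    exact ⟨h1, by rwa [h1, zero_add] at hr⟩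
  let next : P → P := fun a => ⟨a.1 + v a, E.add_mem a.2.1 (hv a).2, by
    intro r hr
    obtain ⟨h1, h2⟩ := key a _ hr
    have hva : v a * a.1 = 0 := (hv a).1
    rw [mul_assoc, add_mul, hva, add_zero, ← mul_assoc] at h1
    have h1' := a.2.2 r h1
    rw [mul_add, h1', zero_add] at h2
    rw [mul_add, h1', hvv a r h2, add_zero]⟩
  let seq : ℕ → P := fun n => next^[n] ⟨0, E.zero_mem, by simp⟩
  have hseq : ∀ n, seq (n + 1) = next (seq n) := fun n => Function.iterate_succ_apply' ..
  obtain ⟨i, hi⟩ := hR.exists_eq_bot (fun n => leftAnnihilator (seq n).1)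
    (fun n => Ideal.span {v (seq n)})
    (antitone_nat_of_succ_le fun n r hr => by
      rw [hseq, mem_leftAnnihilator] at hr; exact (key _ r hr).1)
    (fun n => by rw [Ideal.span_singleton_le_iff_mem]; exact (hv _).1)
    (fun n => by
      rw [Submodule.disjoint_def]
      intro z hz hz'
      obtain ⟨r, rfl⟩ := Ideal.mem_span_singleton'.1 hz
      rw [hseq, mem_leftAnnihilator] at hz'
      exact hvv _ r (key _ _ hz').2)
  rw [Ideal.span_singleton_eq_bot] at hi
  exact hv0 _ hi

/-- The left Ore condition for the non-zero-divisors of a prime left Goldie ring. -/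
theorem IsLeftGoldie.exists_mul_eq_mul (hR : IsLeftGoldie R) (hp : IsPrimeRing R) (r : R) {s : R}
    (hs : s ∈ R⁰) : ∃ s' ∈ R⁰, ∃ r', s' * r = r' * s := by
  let F : Ideal R :=
    { carrier := {t | t * r ∈ Ideal.span {s}}
      add_mem' := fun ha hb => by
        simp only [Set.mem_ofPred_eq] at ha hb ⊢
        rw [add_mul]; exact add_mem ha hb
      zero_mem' := by simp
      smul_mem' := fun c x hx => by
        simp only [Set.mem_ofPred_eq, smul_eq_mul] at hx ⊢
        rw [mul_assoc]; exact Ideal.mul_mem_left _ _ hx }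
  have hF : F.IsEssential :=
    (hR.isEssential_span (mem_nonZeroDivisors_iff.1 hs).2).colon r fun _ h => h
  obtain ⟨s', hs', hs''⟩ := hR.exists_mem_nonZeroDivisors hp hF
  obtain ⟨r', hr'⟩ := Ideal.mem_span_singleton'.1 (show s' * r ∈ Ideal.span {s} from hs')
  exact ⟨s', hs'', r', hr'.symm⟩

end Goldie

/-! ### Left fraction rings and fraction modules -/

section LengthTransport

variable {P Q V W : Type*} [Ring P] [Ring Q] [AddCommGroup V] [AddCommGroup W] [Module P V]
  [Module Q W]

theorem Module.length_eq_of_ringEquiv (σ : P ≃+* Q) (e : V ≃+ W)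
    (h : ∀ (p : P) (x : V), e (p • x) = σ p • e x) : Module.length P V = Module.length Q W := by
  let : RingHomInvPair (σ : P →+* Q) (σ.symm : Q →+* P) := RingHomInvPair.of_ringEquiv σ
  let : RingHomInvPair (σ.symm : Q →+* P) (σ : P →+* Q) := RingHomInvPair.of_ringEquiv σ.symm
  let e' : V ≃ₛₗ[(σ : P →+* Q)] W := { e with map_smul' := h }
  apply WithBot.coe_injective
  rw [Module.coe_length, Module.coe_length]
  exact Order.krullDim_eq_of_orderIso (Submodule.orderIsoMapComap e')

end LengthTransport

/-- `f : R → Q` exhibits `Q` as the ring of left fractions of `R` with respect to the set of all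
non-zero-divisors. -/
structure IsLeftFractionRing {R Q : Type*} [Ring R] [Ring Q] (f : R →+* Q) : Prop where
  injective : Function.Injective f
  isUnit : ∀ s ∈ R⁰, IsUnit (f s)
  surj : ∀ q, ∃ s ∈ R⁰, ∃ r, f s * q = f r

/-- `φ : N → V` exhibits the `Q`-module `V` as the module of left fractions of the `R`-module `N`
with respect to the set of all non-zero-divisors. -/
structure IsFractionModule {R Q N V : Type*} [Ring R] [Ring Q] [AddCommGroup N] [AddCommGroup V]
    [Module R N] [Module Q V] (f : R →+* Q) (φ : N →+ V) : Prop where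
  map_smul : ∀ (r : R) (n : N), φ (r • n) = f r • φ n
  surj : ∀ v, ∃ s ∈ R⁰, ∃ n, f s • v = φ n
  ker : ∀ n, φ n = 0 → ∃ s ∈ R⁰, s • n = 0

namespace IsLeftFractionRing

variable {R Q : Type*} [Ring R] [Ring Q] {f : R →+* Q}

/-- Rewriting `r s⁻¹` as a left fraction `s'⁻¹ r'` is exactly the Ore condition. -/
theorem exists_mul_eq_mul (hf : IsLeftFractionRing f) (r : R) {s : R} (hs : s ∈ R⁰) :
    ∃ s' ∈ R⁰, ∃ r', s' * r = r' * s := by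
  obtain ⟨u, hu⟩ := hf.isUnit s hs
  obtain ⟨s', hs', r', h⟩ := hf.surj (f r * (u⁻¹ : Qˣ))
  refine ⟨s', hs', r', hf.injective ?_⟩
  rw [map_mul, map_mul, ← hu, ← h, mul_assoc, mul_assoc, Units.inv_mul, mul_one]

theorem nonempty_oreSet (hf : IsLeftFractionRing f) : Nonempty (OreLocalization.OreSet R⁰) := by
  rw [OreLocalization.nonempty_oreSet_iff]
  refine ⟨fun r₁ r₂ s h => ⟨1, ?_⟩, fun r s => ?_⟩
  · have := (mem_nonZeroDivisors_iff.1 s.2).2 (r₁ - r₂) (by rw [sub_mul, h, sub_self])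
    rw [sub_eq_zero.1 this]
  · obtain ⟨s', hs', r', h⟩ := hf.exists_mul_eq_mul r s.2
    exact ⟨r', ⟨s', hs'⟩, h⟩

/-- Finitely many fractions have a common denominator. -/
theorem exists_common_denominator (hf : IsLeftFractionRing f) {J : Type*} [Finite J] (q : J → Q) :
    ∃ s ∈ R⁰, ∃ r : J → R, ∀ j, f s * q j = f (r j) := by
  classical
  have : Fintype J := Fintype.ofFinite J
  have key : ∀ t : Finset J, ∃ s ∈ R⁰, ∀ j ∈ t, ∃ r, f s * q j = f r := by
    intro t
    induction t using Finset.induction_on with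
    | empty => exact ⟨1, one_mem _, by simp⟩
    | insert a t _ ih =>
      obtain ⟨s, hs, h⟩ := ih
      obtain ⟨s', hs', r', h'⟩ := hf.surj (f s * q a)
      refine ⟨s' * s, mul_mem hs' hs, fun j hj => ?_⟩
      rcases Finset.mem_insert.1 hj with rfl | hj
      · exact ⟨r', by rw [map_mul, mul_assoc, h']⟩
      · obtain ⟨r, hr⟩ := h j hj
        exact ⟨s' * r, by rw [map_mul, mul_assoc, hr, map_mul]⟩
  obtain ⟨s, hs, h⟩ := key Finset.univ
  choose r hr using fun j => h j (Finset.mem_univ j)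
  exact ⟨s, hs, r, hr⟩

theorem of_ore [OreLocalization.OreSet R⁰] :
    IsLeftFractionRing (OreLocalization.numeratorRingHom (R := R) (S := R⁰)) where
  injective := OreLocalization.numeratorHom_inj fun _ h => h.1
  isUnit s hs := OreLocalization.numerator_isUnit (⟨s, hs⟩ : R⁰)
  surj q := by
    induction q using OreLocalization.ind with
    | _ r s =>
      refine ⟨s, s.2, r, ?_⟩
      change (s : R) /ₒ (1 : R⁰) * (r /ₒ s) = r /ₒ 1
      exact OreLocalization.mul_cancel

end IsLeftFractionRing

theorem OreLocalization.exists_ringHom {R A : Type*} [Ring R] [Ring A] (S : Submonoid R)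
    [OreLocalization.OreSet S] (F : R →+* A) (hF : ∀ s ∈ S, IsUnit (F s)) :
    ∃ g : OreLocalization S R →+* A, ∀ r, g (numeratorRingHom r) = F r := by
  choose u hu using hF
  let fS : S →* Aˣ :=
    { toFun := fun s => u s s.2
      map_one' := Units.ext (by rw [hu]; exact map_one F)
      map_mul' := fun a b => Units.ext (by rw [Units.val_mul, hu, hu, hu]; exact map_mul F _ _) }
  have hfS : ∀ s : S, F s = fS s := fun s => (hu s s.2).symm
  exact ⟨universalHom F fS hfS, fun r => universalHom_commutes F fS hfS⟩

/-- Every ring of left fractions is isomorphic to the Ore localization. -/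
theorem IsLeftFractionRing.exists_ringEquiv {R Q : Type*} [Ring R] [Ring Q] {f : R →+* Q}
    (hf : IsLeftFractionRing f) [OreLocalization.OreSet R⁰] :
    ∃ σ : OreLocalization R⁰ R ≃+* Q, ∀ r, σ (OreLocalization.numeratorRingHom r) = f r := by
  have hg := IsLeftFractionRing.of_ore (R := R)
  obtain ⟨g, hgf⟩ := OreLocalization.exists_ringHom R⁰ f hf.isUnit
  refine ⟨RingEquiv.ofBijective g ⟨?_, fun q => ?_⟩, hgf⟩
  · rw [injective_iff_map_eq_zero]
    intro q hq
    obtain ⟨s, hs, r, h⟩ := hg.surj q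
    have : f r = 0 := by rw [← hgf, ← h, map_mul, hq, mul_zero]
    rw [hf.injective (this.trans (map_zero f).symm), map_zero] at h
    exact (hg.isUnit s hs).mul_right_eq_zero.1 h
  · obtain ⟨s, hs, r, h⟩ := hf.surj q
    obtain ⟨w, hw⟩ := hg.isUnit s hs
    refine ⟨(w⁻¹ : _ˣ) * OreLocalization.numeratorRingHom (S := R⁰) r, ?_⟩
    refine (hf.isUnit s hs).mul_left_cancel ?_
    rw [h, ← hgf s, ← map_mul, ← hw, Units.mul_inv_cancel_left, hgf]

/-! ### Base change to a ring of fractions, and Ore dimension in an arbitrary model -/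

section BaseChange

variable {R Q N V : Type*} [Ring R] [Ring Q] [AddCommGroup N] [AddCommGroup V]
    [Module R N] [Module Q V] {f : R →+* Q} {φ : N →+ V}

/-- The class of `1 ⊗ n` in the base change. -/
noncomputable def BaseChange.ofElem (f : R →+* Q) (n : N) : BaseChange f N :=
  Submodule.Quotient.mk (1 ⊗ₜ[ℤ] n)

theorem BaseChange.smul_ofElem (f : R →+* Q) (r : R) (n : N) :
    f r • BaseChange.ofElem f n = BaseChange.ofElem f (r • n) := by
  rw [BaseChange.ofElem, BaseChange.ofElem, ← Submodule.Quotient.mk_smul, Submodule.Quotient.eq]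
  refine Submodule.subset_span ⟨1, r, n, ?_⟩
  rw [TensorProduct.smul_tmul', smul_eq_mul, mul_one, one_mul]

theorem BaseChange.ofElem_add (f : R →+* Q) (n n' : N) :
    BaseChange.ofElem f (n + n') = BaseChange.ofElem f n + BaseChange.ofElem f n' := by
  rw [BaseChange.ofElem, TensorProduct.tmul_add]; rfl

theorem BaseChange.exists_smul_eq (hf : IsLeftFractionRing f) (x : BaseChange f N) :
    ∃ s ∈ R⁰, ∃ n, f s • x = BaseChange.ofElem f n := by
  obtain ⟨x, rfl⟩ := Submodule.Quotient.mk_surjective _ x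
  induction x using TensorProduct.induction_on with
  | zero =>
    exact ⟨1, one_mem _, 0, by simp [BaseChange.ofElem]⟩
  | tmul q n =>
    obtain ⟨s, hs, r, h⟩ := hf.surj q
    refine ⟨s, hs, r • n, ?_⟩
    rw [← BaseChange.smul_ofElem, ← h, BaseChange.ofElem, mul_smul,
      ← Submodule.Quotient.mk_smul _ q, TensorProduct.smul_tmul', smul_eq_mul, mul_one]
  | add x y hx hy =>
    obtain ⟨s, hs, n, h⟩ := hx
    obtain ⟨s', hs', n', h'⟩ := hy
    obtain ⟨a, ha, b, hab⟩ := hf.exists_mul_eq_mul s hs'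
    refine ⟨a * s, mul_mem ha hs, a • n + b • n', ?_⟩
    rw [Submodule.Quotient.mk_add, smul_add, BaseChange.ofElem_add, ← BaseChange.smul_ofElem,
      ← BaseChange.smul_ofElem, ← h, ← h', smul_smul, smul_smul, ← map_mul, ← map_mul, hab]

/-- The canonical map from the base change to a `Q`-module. -/
noncomputable def BaseChange.lift (f : R →+* Q) (φ : N →+ V)
    (h : ∀ (r : R) (n : N), φ (r • n) = f r • φ n) : BaseChange f N →ₗ[Q] V :=
  Submodule.liftQ _
    (TensorProduct.AlgebraTensorModule.lift
      (LinearMap.toSpanSingleton Q (N →ₗ[ℤ] V) φ.toIntLinearMap)) <| by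
    rw [Submodule.span_le]
    rintro _ ⟨q, r, n, rfl⟩
    simp [h, mul_smul]

theorem BaseChange.lift_ofElem (f : R →+* Q) (φ : N →+ V)
    (h : ∀ (r : R) (n : N), φ (r • n) = f r • φ n) (n : N) :
    BaseChange.lift f φ h (BaseChange.ofElem f n) = φ n := by
  simp [BaseChange.lift, BaseChange.ofElem]

/-- Every element of the base change is a single fraction `s⁻¹(1 ⊗ n)`. If it maps to zero, then `φ
n = 0`, so some regular `t` kills `n`, and `t` is invertible in `Q`. -/
theorem IsFractionModule.lift_bijective (hf : IsLeftFractionRing f) (hφ : IsFractionModule f φ) :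
    Function.Bijective (BaseChange.lift f φ hφ.map_smul) := by
  constructor
  · rw [injective_iff_map_eq_zero]
    intro x hx
    obtain ⟨s, hs, n, h⟩ := BaseChange.exists_smul_eq hf x
    have h0 : φ n = 0 := by
      rw [← BaseChange.lift_ofElem f φ hφ.map_smul, ← h, LinearMap.map_smul, hx, smul_zero]
    obtain ⟨t, ht, htn⟩ := hφ.ker n h0
    have := hf.isUnit _ (mul_mem ht hs)
    rw [← this.smul_eq_zero, map_mul, mul_smul, h, BaseChange.smul_ofElem, htn,
      BaseChange.ofElem, TensorProduct.tmul_zero, Submodule.Quotient.mk_zero]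
  · intro v
    obtain ⟨s, hs, n, h⟩ := hφ.surj v
    obtain ⟨u, hu⟩ := hf.isUnit s hs
    refine ⟨(u⁻¹ : Qˣ) • BaseChange.ofElem f n, ?_⟩
    rw [Units.smul_def, LinearMap.map_smul, BaseChange.lift_ofElem, ← h, ← hu, smul_smul, Units.inv_mul,
      one_smul]

/-- Two fraction modules of the same module have the same length. -/
theorem IsFractionModule.length_eq {V' : Type*} [AddCommGroup V'] [Module Q V'] {φ' : N →+ V'}
    (hf : IsLeftFractionRing f) (hφ : IsFractionModule f φ) (hφ' : IsFractionModule f φ') :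
    Module.length Q V = Module.length Q V' :=
  ((LinearEquiv.ofBijective _ (hφ.lift_bijective hf)).symm.trans
    (LinearEquiv.ofBijective _ (hφ'.lift_bijective hf))).length_eq

/-- The Ore dimension can be computed in any model of the ring of fractions. -/
theorem oreDim_eq (hf : IsLeftFractionRing f) (hφ : IsFractionModule f φ) :
    oreDim R N = ((Module.length Q V : ℕ∞) : ℝ≥0∞) / ((Module.length Q Q : ℕ∞) : ℝ≥0∞) := by
  have hne := hf.nonempty_oreSet
  rw [oreDim, dif_pos hne]
  -- The Ore structure used by `oreDim` is an arbitrary choice; the isomorphism `σ` below shows that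
  -- the value does not depend on it.
  let := Classical.choice hne
  rw [oreDimOfOreSet]
  have hg := IsLeftFractionRing.of_ore (R := R)
  obtain ⟨σ, hσ⟩ := hf.exists_ringEquiv
  let : Module (OreLocalization R⁰ R) V := Module.compHom V (σ : OreLocalization R⁰ R →+* Q)
  have hφ' : IsFractionModule (OreLocalization.numeratorRingHom (R := R) (S := R⁰)) φ :=
    { map_smul := fun r n => by
        rw [hφ.map_smul, ← hσ]; rfl
      surj := fun v => by
        obtain ⟨s, hs, n, h⟩ := hφ.surj v
        exact ⟨s, hs, n, by rw [← h, ← hσ]; rfl⟩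
      ker := hφ.ker }
  have h1 := (LinearEquiv.ofBijective _ (hφ'.lift_bijective hg)).length_eq
  have h2 : Module.length (OreLocalization R⁰ R) V = Module.length Q V :=
    Module.length_eq_of_ringEquiv σ (AddEquiv.refl V) fun _ _ => rfl
  have h3 : Module.length (OreLocalization R⁰ R) (OreLocalization R⁰ R) = Module.length Q Q :=
    Module.length_eq_of_ringEquiv σ σ.toAddEquiv fun a b => map_mul σ a b
  rw [h1, h2, h3]

end BaseChange

/-! ### Ore localization of modules -/

section OreModule

variable {R : Type*} [Ring R] (S : Submonoid R) [OreLocalization.OreSet S]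
  (N : Type*) [AddCommGroup N] [Module R N]

/-- The canonical map from a module to its Ore localization. -/
noncomputable def OreLocalization.moduleHom : N →+ OreLocalization S N where
  toFun n := n /ₒ 1
  map_zero' := OreLocalization.zero_oreDiv 1
  map_add' _ _ := OreLocalization.add_oreDiv.symm

variable {N}

theorem OreLocalization.moduleHom_smul (r : R) (n : N) :
    moduleHom S N (r • n) = numeratorRingHom (S := S) r • moduleHom S N n :=
  OreLocalization.smul_div_one.symm

theorem OreLocalization.exists_smul_eq_moduleHom (x : OreLocalization S N) :
    ∃ s ∈ S, ∃ n, numeratorRingHom (S := S) s • x = moduleHom S N n := by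
  induction x using OreLocalization.ind with
  | _ n s => exact ⟨s, s.2, n, OreLocalization.smul_cancel⟩

theorem OreLocalization.moduleHom_eq_zero {n : N} (h : moduleHom S N n = 0) :
    ∃ s ∈ S, s • n = 0 := by
  change n /ₒ (1 : S) = 0 at h
  rw [OreLocalization.zero_def, OreLocalization.oreDiv_eq_iff] at h
  obtain ⟨u, v, h1, h2⟩ := h
  refine ⟨u, u.2, ?_⟩
  rw [smul_zero] at h1
  simp only [OneMemClass.coe_one, mul_one] at h2
  rw [h2, ← h1]

end OreModule

/-! ### Extension of left ideals to the ring of fractions -/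

section Extension

variable {R Q : Type*} [Ring R] [Ring Q] {f : R →+* Q}

/-- Fractions `t⁻¹ i` are closed under addition by common denominators, and under left
multiplication because `q t⁻¹` is again a left fraction. -/
theorem IsLeftFractionRing.exists_of_mem_map (hf : IsLeftFractionRing f) {I : Ideal R} {x : Q}
    (hx : x ∈ I.map f) : ∃ t ∈ R⁰, ∃ i ∈ I, f t * x = f i := by
  induction hx using Submodule.span_induction with
  | mem x h =>
    obtain ⟨i, hi, rfl⟩ := h
    exact ⟨1, one_mem _, i, hi, by simp⟩
  | zero => exact ⟨1, one_mem _, 0, I.zero_mem, by simp⟩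
  | add x y _ _ hx hy =>
    obtain ⟨s, hs, i, hi, h⟩ := hx
    obtain ⟨t, ht, j, hj, h'⟩ := hy
    obtain ⟨a, ha, b, hab⟩ := hf.exists_mul_eq_mul s ht
    refine ⟨a * s, mul_mem ha hs, a * i + b * j,
      add_mem (I.mul_mem_left _ hi) (I.mul_mem_left _ hj), ?_⟩
    rw [mul_add, map_add, map_mul f a i, map_mul f b j, ← h, ← h', ← mul_assoc, ← mul_assoc,
      ← map_mul, ← map_mul, hab]
  | smul q x _ hx =>
    obtain ⟨t, ht, i, hi, h⟩ := hx
    obtain ⟨u, hu⟩ := hf.isUnit t ht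
    obtain ⟨s, hs, r, h'⟩ := hf.surj (q * (u⁻¹ : Qˣ))
    refine ⟨s, hs, r * i, I.mul_mem_left _ hi, ?_⟩
    rw [map_mul, ← h, ← h', ← hu, smul_eq_mul]
    simp only [mul_assoc, Units.inv_mul_cancel_left]

/-- With `x = s a` and `y = t b` in `R`, one has `x r y = s · a (r t) b`, so the test on elements
descends to numerators. -/
theorem IsLeftFractionRing.isPrimeRing (hf : IsLeftFractionRing f) (hR : IsPrimeRing R) :
    IsPrimeRing Q := by
  refine isPrimeRing_of_forall fun a b h => ?_
  obtain ⟨s, hs, x, hx⟩ := hf.surj a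
  obtain ⟨t, ht, y, hy⟩ := hf.surj b
  have key : x = 0 ∨ y = 0 := by
    refine hR.eq_zero_or_eq_zero fun r => hf.injective ?_
    have := h (f r * f t)
    rw [map_mul, map_mul, ← hx, ← hy, map_zero]
    calc f s * a * f r * (f t * b) = f s * (a * (f r * f t) * b) := by simp only [mul_assoc]
      _ = 0 := by rw [this, mul_zero]
  refine key.imp ?_ ?_
  · rintro rfl
    rw [map_zero] at hx
    exact (hf.isUnit s hs).mul_right_eq_zero.1 hx
  · rintro rfl
    rw [map_zero] at hy
    exact (hf.isUnit t ht).mul_right_eq_zero.1 hy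

theorem exists_maximal_disjoint {M : Type*} [AddCommGroup M] [Module R M] (I : Submodule R M) :
    ∃ I' : Submodule R M, Maximal (fun J => Disjoint I J) I' := by
  obtain ⟨m, -, hm⟩ := zorn_le_nonempty₀ {J : Submodule R M | Disjoint I J} (fun c hc hch y hy => by
    exact ⟨sSup c, hch.directedOn.disjoint_sSup_right.2 fun z hz => hc hz,
      fun z hz => le_sSup hz⟩) ⊥ disjoint_bot_right
  exact ⟨m, hm⟩

/-- The ring of fractions of a prime left Goldie ring is semisimple. -/
theorem IsLeftFractionRing.isSemisimpleRing (hf : IsLeftFractionRing f) (hp : IsPrimeRing R)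
    (hR : IsLeftGoldie R) : IsSemisimpleRing Q := by
  refine (isSemisimpleModule_iff Q Q).2 ⟨fun J => ?_⟩
  let I : Ideal R := Ideal.comap f J
  obtain ⟨I', hI', hmax⟩ := exists_maximal_disjoint I
  -- If `Rx` met `I + I'` trivially, then `I' + Rx` would still be disjoint from `I`, forcing `x ∈
  -- I'`.
  have hess : (I ⊔ I').IsEssential := by
    intro x hx
    by_contra! h
    have hd : Disjoint I (I' ⊔ Ideal.span {x}) := by
      rw [Submodule.disjoint_def]
      intro y hy hy'
      obtain ⟨i, hi, z, hz, rfl⟩ := Submodule.mem_sup.1 hy'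
      obtain ⟨r, rfl⟩ := Ideal.mem_span_singleton'.1 hz
      have hr := h r (by
        have := sub_mem (Submodule.mem_sup_left (T := I') hy)
          (Submodule.mem_sup_right (S := I) hi)
        rwa [add_sub_cancel_left] at this)
      rw [hr, add_zero] at hy ⊢
      exact Submodule.disjoint_def.1 hI' _ hy hi
    have hxI : x ∈ I' := hmax hd le_sup_left
      (Submodule.mem_sup_right (Ideal.mem_span_singleton_self x))
    exact hx (by simpa using h 1 (by rw [one_mul]; exact Submodule.mem_sup_right hxI))
  -- A regular element `i + i'` of `I + I'` becomes a unit, so `J` and `Q I'` together span `Q`.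
  obtain ⟨s, hs, hs'⟩ := hR.exists_mem_nonZeroDivisors hp hess
  obtain ⟨i, hi, i', hi', rfl⟩ := Submodule.mem_sup.1 hs
  refine ⟨Ideal.map f I', ?_, ?_⟩
  · rw [Submodule.disjoint_def]
    intro q hq hq'
    obtain ⟨t, ht, j, hj, h⟩ := hf.exists_of_mem_map hq'
    have hjI : j ∈ I := by
      change f j ∈ J
      rw [← h]
      exact J.smul_mem _ hq
    rw [Submodule.disjoint_def.1 hI' _ hjI hj, map_zero] at h
    exact (hf.isUnit t ht).mul_right_eq_zero.1 h
  · rw [codisjoint_iff]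
    refine Ideal.eq_top_of_isUnit_mem _ ?_ (hf.isUnit _ hs')
    rw [map_add]
    exact add_mem (Submodule.mem_sup_left hi)
      (Submodule.mem_sup_right (Ideal.mem_map_of_mem f hi'))

/-- A ring is left Goldie if its ring of fractions has finite length. -/
theorem IsLeftFractionRing.isLeftGoldie (hf : IsLeftFractionRing f) [IsArtinian Q Q]
    [IsNoetherian Q Q] : IsLeftGoldie R := by
  constructor
  · obtain ⟨d, hd⟩ := ENat.ne_top_iff_exists.1 (Module.length_ne_top (R := Q) (M := Q))
    refine ⟨d, fun n I hne hI => ?_⟩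
    -- The partial sums of an independent family stay strictly increasing after extension to `Q`, so
    -- the length of `Q` bounds the number of summands.
    let A : ℕ → Ideal R := fun m => ⨆ i : Fin n, ⨆ (_ : (i : ℕ) < m), I i
    have hmono : ∀ m m', m ≤ m' → A m ≤ A m' := fun m m' h =>
      iSup_mono fun i => iSup_mono' fun hi => ⟨hi.trans_le h, le_rfl⟩
    have hstrict : ∀ m m', m < m' → m' ≤ n → (A m).map f < (A m').map f := by
      intro m m' hm hn
      refine lt_of_le_not_ge (Ideal.map_mono (hmono _ _ hm.le)) fun hle => ?_
      let i : Fin n := ⟨m, hm.trans_le hn⟩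
      obtain ⟨x, hx, hx0⟩ := Submodule.exists_mem_ne_zero_of_ne_bot (hne i)
      have hxA : f x ∈ (A m).map f := hle (Ideal.mem_map_of_mem f
        ((le_iSup_of_le i (le_iSup_of_le hm le_rfl) : I i ≤ A m') hx))
      obtain ⟨t, ht, y, hy, h⟩ := hf.exists_of_mem_map hxA
      rw [← map_mul] at h
      have hty := hf.injective h
      have hle' : A m ≤ ⨆ (j : Fin n) (_ : j ≠ i), I j := iSup_mono fun j => iSup_mono' fun hj =>
        ⟨fun hji => by rw [hji] at hj; exact lt_irrefl _ hj, le_rfl⟩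
      have h0 := Submodule.disjoint_def.1 (hI i) (t * x) ((I i).mul_mem_left _ hx)
        (hle' (by rw [hty]; exact hy))
      exact hx0 ((mem_nonZeroDivisors_iff.1 ht).1 _ h0)
    let s : LTSeries (Ideal Q) := LTSeries.mk n (fun m => (A m).map f) fun a b hab =>
      hstrict a b hab (Nat.lt_succ_iff.1 b.2)
    have hs := Order.LTSeries.length_le_krullDim s
    rw [← Module.coe_length, ← hd] at hs
    exact_mod_cast hs
  · intro x hx
    have key : ∀ y z : R, leftAnnihilator y ≤ leftAnnihilator z →
        leftAnnihilator (f y) ≤ leftAnnihilator (f z) := by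
      intro y z h q hq
      rw [mem_leftAnnihilator] at hq ⊢
      obtain ⟨s, hs, r, hr⟩ := hf.surj q
      have hry : r * y = 0 := hf.injective (by rw [map_mul, ← hr, mul_assoc, hq, mul_zero, map_zero])
      have hrz : r * z = 0 := h hry
      rw [← (hf.isUnit s hs).mul_right_eq_zero, ← mul_assoc, hr, ← map_mul, hrz, map_zero]
    have key' : ∀ y z : R, leftAnnihilator (f y) ≤ leftAnnihilator (f z) →
        leftAnnihilator y ≤ leftAnnihilator z := by
      intro y z h r hr
      refine hf.injective ?_
      rw [map_mul, map_zero]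
      refine h (x := f r) ?_
      rw [mem_leftAnnihilator, ← map_mul, mem_leftAnnihilator.1 hr, map_zero]
    obtain ⟨n, hn⟩ := monotone_stabilizes_iff_noetherian.2 (inferInstance : IsNoetherian Q Q)
      ⟨fun n => leftAnnihilator (f (x n)), fun a b h => key _ _ (hx h)⟩
    exact ⟨n, fun m hm => le_antisymm (key' _ _ (hn m hm).ge) (hx hm)⟩

end Extension

/-! ### Prime Artinian rings -/

section PrimeArtinian

variable {Q : Type*} [Ring Q]

/-- If `I ^ (n + 2) = 0`, then `I ^ (n + 1)` has square zero, so each of its elements `a` satisfies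
`a Q a = 0` and vanishes. The exponents stay positive because the power law for one-sided ideals
needs this. -/
theorem IsPrimeRing.eq_bot_of_isNilpotent (hQ : IsPrimeRing Q) {I : Ideal Q}
    (hI : IsNilpotent I) : I = ⊥ := by
  obtain ⟨n, hn⟩ := hI
  have hn' : I ^ (n + 1) = ⊥ := le_bot_iff.1 ((Ideal.pow_le_pow_right n.le_succ).trans hn.le)
  clear hn
  induction n with
  | zero => rwa [zero_add, Submodule.pow_one] at hn'
  | succ n ih =>
    refine ih (le_bot_iff.1 fun a ha => ?_)
    refine (hQ.eq_zero_or_eq_zero (a := a) (b := a) fun r => ?_).elim id id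
    have h1 : a * (r * a) ∈ I ^ (n + 1) * I ^ (n + 1) :=
      Ideal.mul_mem_mul ha ((I ^ (n + 1)).mul_mem_left r ha)
    have h2 : I ^ (n + 1) * I ^ (n + 1) = ⊥ := by
      rw [← Submodule.pow_add _ n.succ_ne_zero]
      exact le_bot_iff.1 ((Ideal.pow_le_pow_right (by omega)).trans hn'.le)
    rw [h2] at h1
    rw [mul_assoc]
    exact h1

/-- The Jacobson radical of an Artinian ring is nilpotent, hence zero by primeness. -/
theorem IsPrimeRing.isSemisimpleRing [IsArtinianRing Q] (hQ : IsPrimeRing Q) :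
    IsSemisimpleRing Q :=
  IsArtinianRing.isSemisimpleRing_iff_jacobson.2
    (hQ.eq_bot_of_isNilpotent IsSemiprimaryRing.isNilpotent)

/-- Over a prime semisimple ring, all simple modules are isomorphic. -/
theorem IsPrimeRing.nonempty_linearEquiv [IsSemisimpleRing Q] (hQ : IsPrimeRing Q)
    (M M' : Type*) [AddCommGroup M] [Module Q M] [AddCommGroup M'] [Module Q M']
    [IsSimpleModule Q M] [IsSimpleModule Q M'] : Nonempty (M ≃ₗ[Q] M') := by
  obtain ⟨I, ⟨e⟩⟩ := IsSemisimpleRing.exists_linearEquiv_ideal_of_isSimpleModule Q M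
  obtain ⟨I', ⟨e'⟩⟩ := IsSemisimpleRing.exists_linearEquiv_ideal_of_isSimpleModule Q M'
  have := IsSimpleModule.congr e.symm
  have := IsSimpleModule.congr e'.symm
  have := IsSimpleModule.nontrivial Q I
  have := IsSimpleModule.nontrivial Q I'
  obtain ⟨x, hx⟩ := exists_ne (0 : I)
  obtain ⟨y, hy⟩ := exists_ne (0 : I')
  obtain ⟨q, hq⟩ : ∃ q, (x : Q) * q * y ≠ 0 := by
    by_contra! h
    rcases hQ.eq_zero_or_eq_zero h with h | h
    exacts [hx (Subtype.ext h), hy (Subtype.ext h)]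
  -- Right multiplication by `q y` is a nonzero map between simple left ideals; Schur's lemma
  -- applies.
  let g : I →ₗ[Q] I' :=
    { toFun := fun z => ⟨z * q * y, I'.mul_mem_left _ y.2⟩
      map_add' := fun a b => Subtype.ext (by simp [add_mul])
      map_smul' := fun a b => Subtype.ext (by simp [mul_assoc]) }
  have hg : g ≠ 0 := fun h => hq (congrArg Subtype.val (LinearMap.congr_fun h x))
  exact ⟨e.trans ((LinearEquiv.ofBijective g (LinearMap.bijective_of_ne_zero hg)).trans e'.symm)⟩

/-- Induction along a composition series: each factor is isomorphic to `L` and contributes the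
`P`-length of `L`. -/
theorem IsPrimeRing.length_restrictScalars_of_isFiniteLength [IsSemisimpleRing Q]
    (hQ : IsPrimeRing Q) {P : Type*} [Ring P] [SMul P Q]
    (L : Type*) [AddCommGroup L] [Module Q L] [IsSimpleModule Q L] [Module P L]
    [IsScalarTower P Q L] (V : Type*) [AddCommGroup V] [Module Q V] (hV : IsFiniteLength Q V) :
    ∀ [Module P V] [IsScalarTower P Q V],
      Module.length P V = Module.length Q V * Module.length P L := by
  induction hV with
  | of_subsingleton => intros; simp
  | @of_simple_quotient M _ _ N _ _ ih =>
    intros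
    obtain ⟨e⟩ := hQ.nonempty_linearEquiv (M ⧸ N) L
    rw [Module.length_eq_add_of_exact (R := Q) N.subtype N.mkQ N.injective_subtype
        N.mkQ_surjective (LinearMap.exact_subtype_mkQ N),
      Module.length_eq_add_of_exact (R := P) (N.subtype.restrictScalars P)
        (N.mkQ.restrictScalars P) N.injective_subtype
        N.mkQ_surjective (LinearMap.exact_subtype_mkQ N), ih,
      (e.restrictScalars P).length_eq, Module.length_eq_one (R := Q) (M := M ⧸ N), add_mul, one_mul]

/-- Restriction of scalars to `P` multiplies the length of modules over a prime semisimple ring by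
the `P`-length of the simple module. -/
theorem IsPrimeRing.length_restrictScalars [IsSemisimpleRing Q] (hQ : IsPrimeRing Q)
    {P : Type*} [Ring P] [SMul P Q]
    (L : Type*) [AddCommGroup L] [Module Q L] [IsSimpleModule Q L] [Module P L]
    [IsScalarTower P Q L]
    (V : Type*) [AddCommGroup V] [Module Q V] [Module P V] [IsScalarTower P Q V] :
    Module.length P V = Module.length Q V * Module.length P L := by
  by_cases hV : IsFiniteLength Q V
  · exact hQ.length_restrictScalars_of_isFiniteLength L V hV
  · have h1 : Module.length Q V = ⊤ := by
      by_contra h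
      exact hV (Module.length_ne_top_iff.1 h)
    have h2 : Module.length P V = ⊤ := by
      rw [← top_le_iff, ← h1, ← Module.length_top (R := Q), ← Module.length_top (R := P)]
      exact Submodule.length_le_length_restrictScalars P (⊤ : Submodule Q V)
    have := IsSimpleModule.nontrivial Q L
    rw [h1, h2, ENat.top_mul (Module.length_pos (R := P)).ne']

end PrimeArtinian

/-! ### Finite normalizing extensions -/

/-- The units `u j` normalize the subring `ι R` of `R'` and form a basis of the left `R`-module
`R'`. -/
structure IsNormalizingBasis {R R' : Type*} [Ring R] [Ring R'] (ι : R →+* R') {J : Type*}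
    [Fintype J] (u : J → R'ˣ) : Prop where
  injective : Function.Injective ι
  conj_left : ∀ j r, ∃ r', u j * ι r = ι r' * u j
  conj_right : ∀ j r, ∃ r', ι r * u j = u j * ι r'
  bijective : Function.Bijective fun c : J → R => ∑ j, ι (c j) * (u j : R')

namespace IsNormalizingBasis

variable {R R' : Type*} [Ring R] [Ring R'] {ι : R →+* R'} {J : Type*} [Fintype J] {u : J → R'ˣ}

theorem eq_zero_of_sum_eq_zero (h : IsNormalizingBasis ι u) {c : J → R}
    (hc : ∑ j, ι (c j) * (u j : R') = 0) (j : J) : c j = 0 :=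
  congrFun (h.bijective.1 (a₁ := c) (a₂ := 0) (by simpa using hc)) j

/-- Normalization moves coefficients across the units, so `u` is also a basis of `R'` as a right
`R`-module. Extended left ideals are easiest to describe in this basis. -/
theorem eq_zero_of_sum_mul_eq_zero (h : IsNormalizingBasis ι u) {c : J → R}
    (hc : ∑ j, (u j : R') * ι (c j) = 0) (j : J) : c j = 0 := by
  choose c' hc' using fun j => h.conj_left j (c j)
  simp only [hc'] at hc
  have := hc' j
  rw [h.eq_zero_of_sum_eq_zero hc j, map_zero, zero_mul, Units.mul_right_eq_zero] at this
  exact h.injective (by rw [this, map_zero])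

theorem exists_eq_sum_mul (h : IsNormalizingBasis ι u) (x : R') :
    ∃ c : J → R, x = ∑ j, (u j : R') * ι (c j) := by
  obtain ⟨c, rfl⟩ := h.bijective.2 x
  choose c' hc' using fun j => h.conj_right j (c j)
  exact ⟨c', by simp only [hc']⟩

theorem mem_nonZeroDivisors_of_conj (h : IsNormalizingBasis ι u) {s s' : R} (hs : s ∈ R⁰) {j : J}
    (hss' : u j * ι s = ι s' * u j) : s' ∈ R⁰ := by
  refine mem_nonZeroDivisors_iff.2 ⟨fun t ht => ?_, fun t ht => ?_⟩
  all_goals obtain ⟨t', ht'⟩ := h.conj_right j t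
  · have : (u j : R') * ι (s * t') = 0 := by
      rw [map_mul, ← mul_assoc, hss', mul_assoc, ← ht', ← mul_assoc, ← map_mul, ht, map_zero,
        zero_mul]
    rw [Units.mul_right_eq_zero] at this
    rw [(mem_nonZeroDivisors_iff.1 hs).1 _ (h.injective (this.trans (map_zero ι).symm)), map_zero,
      mul_zero, Units.mul_left_eq_zero] at ht'
    exact h.injective (ht'.trans (map_zero ι).symm)
  · have : (u j : R') * ι (t' * s) = 0 := by
      rw [map_mul, ← mul_assoc, ← ht', mul_assoc, hss', ← mul_assoc, ← map_mul, ht, map_zero,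
        zero_mul]
    rw [Units.mul_right_eq_zero] at this
    rw [(mem_nonZeroDivisors_iff.1 hs).2 _ (h.injective (this.trans (map_zero ι).symm)), map_zero,
      mul_zero, Units.mul_left_eq_zero] at ht'
    exact h.injective (ht'.trans (map_zero ι).symm)

/-- Left multiplication by `ι s` multiplies each coefficient by `s`; right multiplication multiplies
the `j`-th coefficient by the conjugate of `s` under `u j`, which is regular too. -/
theorem map_mem_nonZeroDivisors (h : IsNormalizingBasis ι u) {s : R} (hs : s ∈ R⁰) :
    ι s ∈ R'⁰ := by
  refine mem_nonZeroDivisors_iff.2 ⟨fun x hx => ?_, fun x hx => ?_⟩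
  all_goals obtain ⟨c, rfl⟩ := h.bijective.2 x
  · rw [Finset.mul_sum] at hx
    simp only [← mul_assoc, ← map_mul] at hx
    have := h.eq_zero_of_sum_eq_zero hx
    simp [fun j => (mem_nonZeroDivisors_iff.1 hs).1 _ (this j)]
  · choose s' hs' using fun j => h.conj_left j s
    rw [Finset.sum_mul] at hx
    simp only [mul_assoc, hs'] at hx
    simp only [← mul_assoc, ← map_mul] at hx
    have := h.eq_zero_of_sum_eq_zero hx
    simp [fun j => (mem_nonZeroDivisors_iff.1 (h.mem_nonZeroDivisors_of_conj hs (hs' j))).2 _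
      (this j)]

/-- The left Ore condition for the non-zero-divisors of `R` passes to `R'`. -/
theorem exists_mul_eq_mul (h : IsNormalizingBasis ι u)
    (hore : ∀ (r s : R), s ∈ R⁰ → ∃ s' ∈ R⁰, ∃ r', s' * r = r' * s) (x : R') {s : R}
    (hs : s ∈ R⁰) : ∃ s' ∈ R⁰, ∃ y, ι s' * x = y * ι s := by
  obtain ⟨c, rfl⟩ := h.bijective.2 x
  refine Finset.sum_induction _ (fun x => ∃ s' ∈ R⁰, ∃ y, ι s' * x = y * ι s) ?_ ?_ ?_
  · rintro x y ⟨s₁, hs₁, x', hx⟩ ⟨s₂, hs₂, y', hy⟩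
    obtain ⟨a, ha, b, hab⟩ := hore s₁ s₂ hs₂
    refine ⟨a * s₁, mul_mem ha hs₁, ι a * x' + ι b * y', ?_⟩
    rw [mul_add, add_mul, mul_assoc, ← hx, mul_assoc, ← hy, ← mul_assoc, ← mul_assoc, ← map_mul,
      ← map_mul, hab]
  · exact ⟨1, one_mem _, 0, by simp⟩
  -- For a monomial `c u_j`, the Ore condition in `R` is applied to `c` and the conjugate of `s` by
  -- `u_j`.
  · intro j _
    obtain ⟨s₁, hs₁⟩ := h.conj_left j s
    obtain ⟨s', hs', r', h'⟩ := hore (c j) s₁ (h.mem_nonZeroDivisors_of_conj hs hs₁)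
    refine ⟨s', hs', ι r' * u j, ?_⟩
    rw [← mul_assoc, ← map_mul, h', mul_assoc, hs₁, map_mul, mul_assoc]

theorem nonempty_oreSet (h : IsNormalizingBasis ι u) (hp : IsPrimeRing R) (hR : IsLeftGoldie R) :
    Nonempty (OreLocalization.OreSet (R⁰.map ι)) := by
  rw [OreLocalization.nonempty_oreSet_iff]
  refine ⟨fun r₁ r₂ s hs => ⟨1, ?_⟩, fun r s => ?_⟩
  · obtain ⟨_, s, hs', rfl⟩ := s
    have := (mem_nonZeroDivisors_iff.1 (h.map_mem_nonZeroDivisors hs')).2 (r₁ - r₂)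
      (by rw [sub_mul, sub_eq_zero]; exact hs)
    rw [sub_eq_zero.1 this]
  · obtain ⟨_, s, hs', rfl⟩ := s
    obtain ⟨s', hs', y, hy⟩ := h.exists_mul_eq_mul
      (fun r s hs => hR.exists_mul_eq_mul hp r hs) r hs'
    exact ⟨y, ⟨_, s', hs', rfl⟩, hy⟩

/-! ### Localizing a normalizing extension at the regular elements of the base -/

section Localization

open OreLocalization

variable [OreSet (R⁰.map ι)]

/-- The same localization `S⁻¹N` is a fraction module over `R` here and over `R'` in
`isFractionModule'`; thus one abelian group carries both lengths entering the dimension formula. -/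
theorem isFractionModule {Q : Type*} [Ring Q] {f : R →+* Q}
    {g : Q →+* OreLocalization (R⁰.map ι) R'}
    (hg : ∀ r, g (f r) = numeratorRingHom (ι r)) (N : Type*) [AddCommGroup N]
    [Module R' N] [Module R N] (hN : ∀ (r : R) (n : N), r • n = ι r • n)
    [Module Q (OreLocalization (R⁰.map ι) N)]
    (hV : ∀ (q : Q) (v : OreLocalization (R⁰.map ι) N), q • v = g q • v) :
    IsFractionModule f (moduleHom (R⁰.map ι) N) where
  map_smul r n := by rw [hN, moduleHom_smul, hV, hg]
  surj v := by
    obtain ⟨_, ⟨s, hs, rfl⟩, n, h⟩ := exists_smul_eq_moduleHom _ v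
    exact ⟨s, hs, n, by rw [hV, hg]; exact h⟩
  ker n hn := by
    obtain ⟨_, ⟨s, hs, rfl⟩, h⟩ := moduleHom_eq_zero _ hn
    exact ⟨s, hs, by rw [hN]; exact h⟩

theorem isFractionModule' (h : IsNormalizingBasis ι u) (N : Type*) [AddCommGroup N]
    [Module R' N] :
    IsFractionModule (numeratorRingHom (R := R') (S := R⁰.map ι)) (moduleHom (R⁰.map ι) N) where
  map_smul r n := moduleHom_smul _ r n
  surj v := by
    obtain ⟨_, ⟨s, hs, rfl⟩, n, h'⟩ := exists_smul_eq_moduleHom _ v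
    exact ⟨ι s, h.map_mem_nonZeroDivisors hs, n, h'⟩
  ker n hn := by
    obtain ⟨_, ⟨s, hs, rfl⟩, h'⟩ := moduleHom_eq_zero _ hn
    exact ⟨ι s, h.map_mem_nonZeroDivisors hs, h'⟩

/-- `S⁻¹R'` is the free module over the ring of fractions `Q` of `R` with basis `u`. -/
theorem length_localization (h : IsNormalizingBasis ι u) {Q : Type*} [Ring Q] {f : R →+* Q}
    (hf : IsLeftFractionRing f) {g : Q →+* OreLocalization (R⁰.map ι) R'}
    (hg : ∀ r, g (f r) = numeratorRingHom (ι r)) [Module Q (OreLocalization (R⁰.map ι) R')]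
    (hV : ∀ (q : Q) (v : OreLocalization (R⁰.map ι) R'), q • v = g q • v) :
    Module.length Q (OreLocalization (R⁰.map ι) R') = Fintype.card J * Module.length Q Q := by
  let : Module R R' := Module.compHom R' ι
  have h1 := isFractionModule hg R' (fun _ _ => rfl) hV
  let e : (J → R) ≃+ R' := AddEquiv.ofBijective
    (AddMonoidHom.mk' (fun c : J → R => ∑ j, ι (c j) * (u j : R')) fun a b => by
      simp [add_mul, Finset.sum_add_distrib]) h.bijective
  have he : ∀ (r : R) (c : J → R), e (r • c) = r • e c := fun r c => by
    change ∑ j, ι (r * c j) * (u j : R') = ι r * ∑ j, ι (c j) * (u j : R')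
    simp only [Finset.mul_sum, map_mul, mul_assoc]
  have he' : ∀ (r : R) (x : R'), e.symm (r • x) = r • e.symm x := fun r x => by
    rw [AddEquiv.symm_apply_eq, he, AddEquiv.apply_symm_apply]
  -- The coefficient map makes `Qᴶ` a second fraction module of `R' ≅ Rᴶ`; uniqueness then gives the
  -- length.
  let φ : R' →+ (J → Q) := (AddMonoidHom.pi fun j => f.toAddMonoidHom.comp
    (Pi.evalAddMonoidHom (fun _ => R) j)).comp e.symm.toAddMonoidHom
  have hφe : ∀ x j, φ x j = f (e.symm x j) := fun _ _ => rfl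
  have h2 : IsFractionModule f φ :=
    { map_smul := fun r x => funext fun j => by
        rw [hφe, he', Pi.smul_apply, Pi.smul_apply, hφe, smul_eq_mul, smul_eq_mul, map_mul]
      surj := fun v => by
        obtain ⟨s, hs, r, hr⟩ := hf.exists_common_denominator v
        exact ⟨s, hs, e r, funext fun j => by
          rw [hφe, AddEquiv.symm_apply_apply, ← hr]; rfl⟩
      ker := fun n hn => by
        have h0 : e.symm n = 0 := funext fun j => hf.injective (by
          rw [← hφe, hn, Pi.zero_apply, Pi.zero_apply, map_zero])
        refine ⟨1, one_mem _, ?_⟩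
        rw [one_smul]
        exact e.symm.map_eq_zero_iff.1 h0 }
  rw [h1.length_eq hf h2, Module.length_pi_of_fintype]
  simp

end Localization

end IsNormalizingBasis

theorem IsLeftGoldie.nonempty_oreSet {R : Type*} [Ring R] (hR : IsLeftGoldie R)
    (hp : IsPrimeRing R) : Nonempty (OreLocalization.OreSet R⁰) := by
  rw [OreLocalization.nonempty_oreSet_iff]
  refine ⟨fun r₁ r₂ s h => ⟨1, ?_⟩, fun r s => ?_⟩
  · have := (mem_nonZeroDivisors_iff.1 s.2).2 (r₁ - r₂) (by rw [sub_mul, h, sub_self])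
    rw [sub_eq_zero.1 this]
  · obtain ⟨s', hs', r', h⟩ := hR.exists_mul_eq_mul hp r s.2
    exact ⟨r', ⟨s', hs'⟩, h⟩

/-! ### The full ring of fractions of a normalizing extension, and descent of the Goldie property -/

namespace IsNormalizingBasis

open OreLocalization

variable {R R' : Type*} [Ring R] [Ring R'] {ι : R →+* R'} {J : Type*} [Fintype J] {u : J → R'ˣ}

section

variable [OreSet (R⁰.map ι)]

/-- `S⁻¹R'` has finite length over the ring of fractions of `R`, hence over itself. -/
theorem isFiniteLength (h : IsNormalizingBasis ι u) (hp : IsPrimeRing R) (hR : IsLeftGoldie R) :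
    IsFiniteLength (OreLocalization (R⁰.map ι) R') (OreLocalization (R⁰.map ι) R') := by
  obtain ⟨_⟩ := hR.nonempty_oreSet hp
  have hf := IsLeftFractionRing.of_ore (R := R)
  have := hf.isSemisimpleRing hp hR
  obtain ⟨g, hg⟩ := exists_ringHom R⁰ ((numeratorRingHom (S := R⁰.map ι)).comp ι) fun s hs =>
    numerator_isUnit (⟨ι s, s, hs, rfl⟩ : R⁰.map ι)
  let : Module (OreLocalization R⁰ R) (OreLocalization (R⁰.map ι) R') := Module.compHom _ g
  have hl := h.length_localization hf hg fun _ _ => rfl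
  have : IsScalarTower (OreLocalization R⁰ R) (OreLocalization (R⁰.map ι) R')
    (OreLocalization (R⁰.map ι) R') := ⟨fun q x v => mul_assoc (g q) x v⟩
  rw [← Module.length_ne_top_iff]
  refine ne_top_of_le_ne_top (b := Module.length (OreLocalization R⁰ R)
    (OreLocalization (R⁰.map ι) R')) ?_ ?_
  · rw [hl]
    exact WithTop.mul_ne_top (ENat.natCast_ne_top _) Module.length_ne_top
  · rw [← Module.length_top, ← Module.length_top (R := OreLocalization R⁰ R)]
    exact Submodule.length_le_length_restrictScalars (OreLocalization R⁰ R)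
      (⊤ : Submodule (OreLocalization (R⁰.map ι) R') (OreLocalization (R⁰.map ι) R'))

/-- `S⁻¹R'` is the full ring of fractions of `R'`. -/
theorem isLeftFractionRing (h : IsNormalizingBasis ι u) (hp : IsPrimeRing R)
    (hR : IsLeftGoldie R) :
    IsLeftFractionRing (numeratorRingHom (R := R') (S := R⁰.map ι)) := by
  have hinj : Function.Injective (numeratorRingHom (R := R') (S := R⁰.map ι)) :=
    numeratorHom_inj fun s hs => by
      obtain ⟨s, hs, rfl⟩ := hs
      exact (h.map_mem_nonZeroDivisors hs).1
  have hsurj : ∀ q : OreLocalization (R⁰.map ι) R', ∃ s ∈ R⁰, ∃ r,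
      numeratorRingHom (ι s) * q = numeratorRingHom r := fun q => by
    obtain ⟨_, ⟨s, hs, rfl⟩, n, h⟩ := exists_smul_eq_moduleHom _ q
    exact ⟨s, hs, n, h⟩
  refine ⟨hinj, fun t ht => ?_, fun q => ?_⟩
  · have := (isFiniteLength_iff_isNoetherian_isArtinian.1 (h.isFiniteLength hp hR)).2
    set t' := numeratorRingHom (S := R⁰.map ι) t with ht'
    have hreg : ∀ q, q * t' = 0 → q = 0 := by
      intro q hq
      obtain ⟨s, hs, r, hr⟩ := hsurj q
      have hrt : r * t = 0 := hinj (by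
        rw [map_mul, ← hr, mul_assoc, ← ht', hq, mul_zero, map_zero])
      rw [(mem_nonZeroDivisors_iff.1 ht).2 _ hrt, map_zero] at hr
      exact (numerator_isUnit (⟨ι s, s, hs, rfl⟩ : R⁰.map ι)).mul_right_eq_zero.1 hr
    -- Right multiplication by `t'` is an injective endomorphism of an Artinian left module, hence
    -- onto. This gives `q t' = 1`, and cancelling `t'` in `(t' q - 1) t' = 0` gives the other side.
    let F : OreLocalization (R⁰.map ι) R' →ₗ[OreLocalization (R⁰.map ι) R']
        OreLocalization (R⁰.map ι) R' := LinearMap.toSpanSingleton _ _ t'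
    have hF : Function.Injective F := by
      rw [injective_iff_map_eq_zero]
      exact hreg
    obtain ⟨q, hq⟩ := IsArtinian.surjective_of_injective_endomorphism F hF 1
    have hq : q * t' = 1 := hq
    refine ⟨⟨t', q, ?_, hq⟩, rfl⟩
    refine sub_eq_zero.1 (hreg _ ?_)
    rw [sub_mul, mul_assoc, hq, mul_one, one_mul, sub_self]
  · obtain ⟨s, hs, r, hr⟩ := hsurj q
    exact ⟨ι s, h.map_mem_nonZeroDivisors hs, r, hr⟩

end

/-- A normalizing extension of a prime left Goldie ring is left Goldie. -/
theorem isLeftGoldie (h : IsNormalizingBasis ι u) (hp : IsPrimeRing R) (hR : IsLeftGoldie R) :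
    IsLeftGoldie R' := by
  obtain ⟨_⟩ := h.nonempty_oreSet hp hR
  obtain ⟨_, _⟩ := isFiniteLength_iff_isNoetherian_isArtinian.1 (h.isFiniteLength hp hR)
  exact (h.isLeftFractionRing hp hR).isLeftGoldie

theorem exists_ringEquiv (h : IsNormalizingBasis ι u) (hp : IsPrimeRing R) (hR : IsLeftGoldie R) :
    ∃ (_ : OreSet (R⁰.map ι)) (_ : OreSet R'⁰)
      (θ : OreLocalization (R⁰.map ι) R' ≃+* OreLocalization R'⁰ R'),
      ∀ x, θ (numeratorHom x) = numeratorHom x := by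
  obtain ⟨i₁⟩ := h.nonempty_oreSet hp hR
  have hf := h.isLeftFractionRing hp hR
  obtain ⟨i₂⟩ := hf.nonempty_oreSet
  obtain ⟨σ, hσ⟩ := hf.exists_ringEquiv
  exact ⟨i₁, i₂, σ.symm, fun x => by rw [RingEquiv.symm_apply_eq]; exact (hσ x).symm⟩

/-- The Ore dimension over `R` is `#J` times the Ore dimension over `R'`. -/
theorem oreDim_div_card [Nontrivial R'] (h : IsNormalizingBasis ι u)
    (hp : IsPrimeRing R)
    (hR : IsLeftGoldie R) (hp' : IsPrimeRing R') (N : Type*) [AddCommGroup N] [Module R' N]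
    [Module R N] (hN : ∀ (r : R) (n : N), r • n = ι r • n) :
    oreDim R N / (Fintype.card J : ℝ≥0∞) = oreDim R' N := by
  obtain ⟨_⟩ := hR.nonempty_oreSet hp
  obtain ⟨_⟩ := h.nonempty_oreSet hp hR
  have hf := IsLeftFractionRing.of_ore (R := R)
  have hf' := h.isLeftFractionRing hp hR
  obtain ⟨_, _⟩ := isFiniteLength_iff_isNoetherian_isArtinian.1 (h.isFiniteLength hp hR)
  have := hf.isSemisimpleRing hp hR
  obtain ⟨g, hg⟩ := exists_ringHom R⁰ ((numeratorRingHom (S := R⁰.map ι)).comp ι) fun s hs =>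
    numerator_isUnit (⟨ι s, s, hs, rfl⟩ : R⁰.map ι)
  let : Module (OreLocalization R⁰ R) (OreLocalization (R⁰.map ι) R') := Module.compHom _ g
  let : Module (OreLocalization R⁰ R) (OreLocalization (R⁰.map ι) N) := Module.compHom _ g
  have : IsScalarTower (OreLocalization R⁰ R) (OreLocalization (R⁰.map ι) R')
    (OreLocalization (R⁰.map ι) R') := ⟨fun q x v => mul_assoc (g q) x v⟩
  have : IsScalarTower (OreLocalization R⁰ R) (OreLocalization (R⁰.map ι) R')
    (OreLocalization (R⁰.map ι) N) := ⟨fun q x v => mul_smul (g q) x v⟩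
  have hQp := hf'.isPrimeRing hp'
  have := hQp.isSemisimpleRing
  have : Nontrivial (OreLocalization (R⁰.map ι) R') := hf'.injective.nontrivial
  have hl := h.length_localization hf hg fun _ _ => rfl
  obtain ⟨L, _⟩ := IsSemisimpleModule.exists_simple_submodule (OreLocalization (R⁰.map ι) R')
    (OreLocalization (R⁰.map ι) R')
  have e₁ := hQp.length_restrictScalars (P := OreLocalization R⁰ R) L
    (OreLocalization (R⁰.map ι) R')
  have e₂ := hQp.length_restrictScalars (P := OreLocalization R⁰ R) L (OreLocalization (R⁰.map ι) N)
  rw [oreDim_eq hf (isFractionModule hg N hN fun _ _ => rfl),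
    oreDim_eq hf' (h.isFractionModule' N), e₂]
  rw [hl] at e₁
  have hq : Module.length (OreLocalization R⁰ R) (OreLocalization R⁰ R) ≠ ⊤ :=
    Module.length_ne_top
  have hq' : Module.length (OreLocalization (R⁰.map ι) R') (OreLocalization (R⁰.map ι) R') ≠ 0 :=
    Module.length_pos.ne'
  have := IsSimpleModule.nontrivial (OreLocalization (R⁰.map ι) R') L
  have hc : Module.length (OreLocalization R⁰ R) L ≠ 0 := Module.length_pos.ne'
  -- The length of `L` may be cancelled in `ℝ≥0∞` only if it is finite; otherwise the finite number
  -- `#J · length Q` would be infinite.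
  have hct : Module.length (OreLocalization R⁰ R) L ≠ ⊤ := fun ht => by
    rw [ht, ENat.mul_top hq'] at e₁
    exact WithTop.mul_ne_top (ENat.natCast_ne_top _) hq e₁
  have e₃ := congrArg ENat.toENNReal e₁
  rw [ENat.toENNReal_mul, ENat.toENNReal_mul, ENat.toENNReal_coe] at e₃
  rw [div_eq_mul_inv, div_eq_mul_inv, mul_assoc, ← ENNReal.mul_inv
    (Or.inr (ENNReal.natCast_ne_top _)) (Or.inl (ENat.toENNReal_ne_top.2 hq)), ← div_eq_mul_inv,
    ENat.toENNReal_mul, mul_comm _ (Fintype.card J : ℝ≥0∞), e₃,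
    ENNReal.mul_div_mul_right _ _ (by simpa using hc) (ENat.toENNReal_ne_top.2 hct)]

/-- With coefficients on the right, left multiplication by `R'` changes them only by left factors
from `R` and sums, which `I` absorbs. -/
theorem exists_of_mem_map (h : IsNormalizingBasis ι u) {I : Ideal R} {x : R'}
    (hx : x ∈ I.map ι) : ∃ c : J → R, (∀ j, c j ∈ I) ∧ x = ∑ j, (u j : R') * ι (c j) := by
  have hadd : ∀ x y : R', (∃ c : J → R, (∀ j, c j ∈ I) ∧ x = ∑ j, (u j : R') * ι (c j)) →
      (∃ c : J → R, (∀ j, c j ∈ I) ∧ y = ∑ j, (u j : R') * ι (c j)) →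
      ∃ c : J → R, (∀ j, c j ∈ I) ∧ x + y = ∑ j, (u j : R') * ι (c j) := by
    rintro _ _ ⟨c, hc, rfl⟩ ⟨d, hd, rfl⟩
    exact ⟨c + d, fun j => add_mem (hc j) (hd j), by simp [mul_add, Finset.sum_add_distrib]⟩
  have hzero : ∃ c : J → R, (∀ j, c j ∈ I) ∧ (0 : R') = ∑ j, (u j : R') * ι (c j) :=
    ⟨0, fun _ => I.zero_mem, by simp⟩
  have hmul : ∀ (q : R') (i : R), i ∈ I →
      ∃ c : J → R, (∀ j, c j ∈ I) ∧ q * ι i = ∑ j, (u j : R') * ι (c j) := by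
    intro q i hi
    obtain ⟨d, rfl⟩ := h.exists_eq_sum_mul q
    exact ⟨fun j => d j * i, fun j => I.mul_mem_left _ hi, by
      simp only [Finset.sum_mul, map_mul, mul_assoc]⟩
  induction hx using Submodule.span_induction with
  | mem x hx =>
    obtain ⟨i, hi, rfl⟩ := hx
    simpa using hmul 1 i hi
  | zero => exact hzero
  | add x y _ _ hx hy => exact hadd x y hx hy
  | smul q x _ hx =>
    obtain ⟨c, hc, rfl⟩ := hx
    rw [smul_eq_mul, Finset.mul_sum]
    refine Finset.sum_induction _ _ hadd hzero fun j _ => ?_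
    rw [← mul_assoc]
    exact hmul _ _ (hc j)

theorem iSupIndep_map (h : IsNormalizingBasis ι u) {n : ℕ} {I : Fin n → Ideal R}
    (hI : iSupIndep I) : iSupIndep fun i => (I i).map ι := by
  rw [iSupIndep_iff_finsetSum_eq_zero_imp_eq_zero] at hI ⊢
  intro s v hv hs i hi
  choose! c hc hvc using fun i hi => h.exists_of_mem_map (hv i hi)
  have h0 : ∀ j, ∑ i ∈ s, c i j = 0 := by
    refine h.eq_zero_of_sum_mul_eq_zero ?_
    simp only [map_sum, Finset.mul_sum]
    rw [Finset.sum_comm, ← hs]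
    exact Finset.sum_congr rfl fun i hi => (hvc i hi).symm
  rw [hvc i hi]
  refine Finset.sum_eq_zero fun j _ => ?_
  rw [hI s (fun i => c i j) (fun i hi => hc i hi j) (h0 j) i hi, map_zero, mul_zero]

/-- The left Goldie property descends along normalizing extensions. -/
theorem isLeftGoldie_of_isLeftGoldie (h : IsNormalizingBasis ι u) (hR' : IsLeftGoldie R') :
    IsLeftGoldie R := by
  constructor
  · obtain ⟨d, hd⟩ := hR'.1
    refine ⟨d, fun n I hne hI => hd n _ (fun i hi => hne i ?_) (h.iSupIndep_map hI)⟩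
    refine le_bot_iff.1 fun x hx => h.injective ?_
    rw [map_zero, ← Submodule.mem_bot R', ← hi]
    exact Ideal.mem_map_of_mem ι hx
  · intro x hx
    -- An element `∑ u_j ι(c_j)` kills `ι x` exactly when every `c_j` kills `x`, so the chain of
    -- annihilators stays monotone in `R'`.
    obtain ⟨n, hn⟩ := hR'.2 (fun n => ι (x n)) fun a b hab q hq => by
      obtain ⟨c, rfl⟩ := h.exists_eq_sum_mul q
      rw [mem_leftAnnihilator, Finset.sum_mul] at hq ⊢
      simp only [mul_assoc, ← map_mul] at hq ⊢
      have := h.eq_zero_of_sum_mul_eq_zero hq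
      exact Finset.sum_eq_zero fun j _ => by
        rw [show c j * x b = 0 from hx hab (this j), map_zero, mul_zero]
    refine ⟨n, fun m hm => le_antisymm (fun r hr => h.injective ?_) (hx hm)⟩
    have : ι r ∈ leftAnnihilator (ι (x m)) := by
      rw [mem_leftAnnihilator, ← map_mul, mem_leftAnnihilator.1 hr, map_zero]
    rw [hn m hm, mem_leftAnnihilator] at this
    rw [map_mul, this, map_zero]

end IsNormalizingBasis

/-! ### Elements with finitely many conjugates -/

section FC

open scoped commutatorElement

variable {G : Type*} [Group G]

/-- The FC-centre `Δ(G)`: the elements whose centralizer has finite index. -/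
def fcCenter (G : Type*) [Group G] : Subgroup G where
  carrier := {g | (Subgroup.centralizer {g}).FiniteIndex}
  one_mem' := by
    have : Subgroup.centralizer ({1} : Set G) = ⊤ := by
      rw [eq_top_iff]
      intro x _
      simp [Subgroup.mem_centralizer_iff]
    simp only [Set.mem_ofPred_eq, this]
    infer_instance
  mul_mem' {a b} ha hb := by
    simp only [Set.mem_ofPred_eq] at ha hb ⊢
    refine Subgroup.finiteIndex_of_le (H := Subgroup.centralizer {a} ⊓ Subgroup.centralizer {b})
      fun x hx => ?_
    rw [Subgroup.mem_inf, Subgroup.mem_centralizer_singleton_iff,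
      Subgroup.mem_centralizer_singleton_iff] at hx
    rw [Subgroup.mem_centralizer_singleton_iff]
    rw [mul_assoc, ← hx.2, ← mul_assoc, hx.1, mul_assoc]
  inv_mem' {a} ha := by
    simp only [Set.mem_ofPred_eq] at ha ⊢
    refine Subgroup.finiteIndex_of_le (H := Subgroup.centralizer {a}) fun x hx => ?_
    rw [Subgroup.mem_centralizer_singleton_iff] at hx ⊢
    exact Commute.inv_right (show Commute x a from hx)

theorem mem_fcCenter {g : G} : g ∈ fcCenter G ↔ (Subgroup.centralizer {g}).FiniteIndex := Iff.rfl

theorem Subgroup.centralizer_conj (x g : G) : Subgroup.centralizer {x * g * x⁻¹}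
    = (Subgroup.centralizer {g}).map (MulAut.conj x).toMonoidHom := by
  ext y
  rw [Subgroup.mem_map_equiv, Subgroup.mem_centralizer_singleton_iff,
    Subgroup.mem_centralizer_singleton_iff]
  simp only [MulAut.conj_symm_apply]
  constructor <;> intro h
  · calc x⁻¹ * y * x * g = x⁻¹ * (y * (x * g * x⁻¹)) * x := by group
      _ = _ := by rw [h]; group
  · calc y * (x * g * x⁻¹) = x * (x⁻¹ * y * x * g) * x⁻¹ := by group
      _ = _ := by rw [h]; group

instance fcCenter_normal : (fcCenter G).Normal where
  conj_mem g hg x := by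
    rw [mem_fcCenter] at hg ⊢
    rw [Subgroup.centralizer_conj, Subgroup.finiteIndex_iff]
    exact (Subgroup.index_map_equiv _ (MulAut.conj x)).trans_ne hg.index_ne_zero

/-- A group whose centre has finite index has finitely many commutators. -/
theorem finite_commutatorSet_of_finiteIndex_center [(Subgroup.center G).FiniteIndex] :
    Finite (commutatorSet G) := by
  -- A commutator depends only on the classes of its entries modulo the centre.
  refine (Set.finite_range fun p : (G ⧸ Subgroup.center G) × (G ⧸ Subgroup.center G) =>
    ⁅p.1.out, p.2.out⁆).subset ?_
  rintro _ ⟨a, b, rfl⟩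
  obtain ⟨z, hz⟩ := QuotientGroup.mk_out_eq_mul (Subgroup.center G) a
  obtain ⟨w, hw⟩ := QuotientGroup.mk_out_eq_mul (Subgroup.center G) b
  refine ⟨(a, b), ?_⟩
  have hz' := Subgroup.mem_center_iff.1 z.2
  have hw' := Subgroup.mem_center_iff.1 w.2
  change ⁅(QuotientGroup.mk a : G ⧸ Subgroup.center G).out,
    (QuotientGroup.mk b : G ⧸ Subgroup.center G).out⁆ = _
  rw [hz, hw, commutatorElement_def, commutatorElement_def, mul_inv_rev, mul_inv_rev]
  calc a * z * (b * w) * ((z : G)⁻¹ * a⁻¹) * ((w : G)⁻¹ * b⁻¹)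
      = a * z * (b * w * (z : G)⁻¹) * a⁻¹ * (w : G)⁻¹ * b⁻¹ := by group
    _ = a * (z * (z : G)⁻¹) * b * (w * a⁻¹ * (w : G)⁻¹) * b⁻¹ := by
        rw [(Commute.inv_right (hz' (b * w)) : b * w * (z : G)⁻¹ = _)]; group
    _ = a * b * a⁻¹ * b⁻¹ := by rw [← hw' a⁻¹]; group

/-- A subgroup generated by finitely many elements of the FC-centre has a centre of finite
index. -/
theorem finiteIndex_center_closure (s : Set G) (hs : s.Finite) (h : s ⊆ fcCenter G) :
    (Subgroup.center (Subgroup.closure s)).FiniteIndex := by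
  have := hs.to_subtype
  have hfi : (⨅ x : s, Subgroup.centralizer {(x : G)}).FiniteIndex :=
    Subgroup.finiteIndex_iInf fun x => h x.2
  refine Subgroup.finiteIndex_of_le
    (H := (⨅ x : s, Subgroup.centralizer {(x : G)}).subgroupOf (Subgroup.closure s)) fun y hy => ?_
  rw [Subgroup.mem_subgroupOf, Subgroup.mem_iInf] at hy
  rw [Subgroup.mem_center_iff]
  rintro ⟨z, hz⟩
  have hle : Subgroup.closure s ≤ Subgroup.centralizer {(y : G)} := by
    rw [Subgroup.closure_le]
    intro x hx
    have := hy ⟨x, hx⟩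
    rw [Subgroup.mem_centralizer_singleton_iff] at this
    rw [SetLike.mem_coe, Subgroup.mem_centralizer_singleton_iff]
    exact this.symm
  have := hle hz
  rw [Subgroup.mem_centralizer_singleton_iff] at this
  exact Subtype.ext this

/-- **Dietzmann's lemma** in the form needed here: finitely many torsion elements of the FC-centre
generate a finite subgroup. -/
theorem finite_closure_of_isOfFinOrder (s : Set G) (hs : s.Finite) (h : s ⊆ fcCenter G)
    (ht : ∀ x ∈ s, IsOfFinOrder x) : Finite (Subgroup.closure s) := by
  have := finiteIndex_center_closure s hs h
  have := finite_commutatorSet_of_finiteIndex_center (G := Subgroup.closure s)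
  -- Schur's theorem: finitely many commutators generate a finite subgroup. The abelianization is
  -- finite as well, being finitely generated and torsion.
  have : Finite (commutator (Subgroup.closure s)) := inferInstance
  have hfg : Group.FG (Subgroup.closure s) := by
    have := hs.to_subtype
    exact Group.closure_finite_fg s
  have hfg' : Group.FG (Abelianization (Subgroup.closure s)) :=
    QuotientGroup.fg (commutator (Subgroup.closure s))
  have htor : IsMulTorsion (Abelianization (Subgroup.closure s)) := by
    intro x
    obtain ⟨⟨x, hx⟩, rfl⟩ := QuotientGroup.mk_surjective x
    induction hx using Subgroup.closure_induction with
    | mem x hx =>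
      exact (Abelianization.of (G := Subgroup.closure s)).isOfFinOrder
        (Submonoid.isOfFinOrder_coe.1 (ht x hx) : IsOfFinOrder
          (⟨x, Subgroup.subset_closure hx⟩ : Subgroup.closure s))
    | one => exact IsOfFinOrder.one
    | mul x y hx hy hx' hy' => exact hx'.mul hy'
    | inv x hx hx' => exact hx'.inv
  have : Finite (Abelianization (Subgroup.closure s)) := CommGroup.finite_of_fg_isMulTorsion _ htor
  have : Finite (Subgroup.closure s ⧸ commutator (Subgroup.closure s)) := this
  exact Finite.of_subgroup_quotient (commutator (Subgroup.closure s))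

/-- The torsion elements of the FC-centre are trivial. -/
def FCTorsionFree (G : Type*) [Group G] : Prop :=
  ∀ g ∈ fcCenter G, IsOfFinOrder g → g = 1

/-- A torsion element of the FC-centre has finitely many conjugates, all of the same kind; by
Dietzmann's lemma its normal closure is finite and so lies in `Δ⁺`. -/
theorem fcTorsionFree_of_deltaPlus_eq_bot (h : deltaPlus G = ⊥) : FCTorsionFree G := by
  intro g hg hfin
  have hfi := mem_fcCenter.1 hg
  have hconj : (Set.range fun x : G => x * g * x⁻¹).Finite := by
    refine (Set.finite_range fun q : G ⧸ Subgroup.centralizer {g} =>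
      q.out * g * q.out⁻¹).subset ?_
    rintro _ ⟨x, rfl⟩
    refine ⟨x, ?_⟩
    obtain ⟨z, hz⟩ := QuotientGroup.mk_out_eq_mul (Subgroup.centralizer {g}) x
    have := Subgroup.mem_centralizer_singleton_iff.1 z.2
    change (QuotientGroup.mk x : G ⧸ Subgroup.centralizer {g}).out * g *
      (QuotientGroup.mk x : G ⧸ Subgroup.centralizer {g}).out⁻¹ = _
    rw [hz, mul_assoc x, this]
    group
  have heq : Group.conjugatesOfSet {g} = Set.range fun x : G => x * g * x⁻¹ := by
    ext y
    simp [Group.mem_conjugatesOfSet_iff, isConj_iff]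
  have hfinite : Finite (Subgroup.normalClosure {g}) := by
    rw [Subgroup.normalClosure, heq]
    exact finite_closure_of_isOfFinOrder _ hconj
      (by rintro _ ⟨x, rfl⟩; exact fcCenter_normal.conj_mem g hg x)
      (by rintro _ ⟨x, rfl⟩; exact (MulAut.conj x).toMonoidHom.isOfFinOrder hfin)
  have hle : Subgroup.normalClosure {g} ≤ deltaPlus G :=
    le_sSup ⟨Subgroup.normalClosure_normal, hfinite⟩
  rw [h] at hle
  exact Subgroup.mem_bot.1 (hle (Subgroup.subset_normalClosure rfl))

/-- A centralizer of finite index in `K` has finite index in `G`, so the FC-centre of `K` lies in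
that of `G`. -/
theorem FCTorsionFree.subgroup (h : FCTorsionFree G) (K : Subgroup G) [K.FiniteIndex] :
    FCTorsionFree K := by
  intro g hg hfin
  refine Subtype.ext (h g ?_ (Submonoid.isOfFinOrder_coe.2 hfin))
  have hg' := mem_fcCenter.1 hg
  rw [mem_fcCenter]
  have : ((Subgroup.centralizer {g}).map K.subtype).FiniteIndex := by
    rw [Subgroup.finiteIndex_iff, Subgroup.index_map_subtype]
    exact mul_ne_zero hg'.index_ne_zero Subgroup.FiniteIndex.index_ne_zero
  refine Subgroup.finiteIndex_of_le (H := (Subgroup.centralizer {g}).map K.subtype) ?_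
  rintro _ ⟨x, hx, rfl⟩
  rw [SetLike.mem_coe, Subgroup.mem_centralizer_singleton_iff] at hx
  rw [Subgroup.mem_centralizer_singleton_iff]
  exact congrArg Subtype.val hx

/-- By Schur's theorem the subgroup generated by `a` and `b` has finite commutator subgroup, so `⁅a,
b⁆` is a torsion element of the FC-centre. -/
theorem FCTorsionFree.commute (h : FCTorsionFree G) {a b : G} (ha : a ∈ fcCenter G)
    (hb : b ∈ fcCenter G) : a * b = b * a := by
  let N := Subgroup.closure ({a, b} : Set G)
  have := finiteIndex_center_closure {a, b} (Set.toFinite _) (by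
    rintro x (rfl | rfl) <;> assumption)
  have := finite_commutatorSet_of_finiteIndex_center (G := N)
  have : Finite (commutator N) := inferInstance
  let a' : N := ⟨a, Subgroup.subset_closure (by simp)⟩
  let b' : N := ⟨b, Subgroup.subset_closure (by simp)⟩
  have hc : ⁅a', b'⁆ ∈ commutator N :=
    Subgroup.commutator_mem_commutator (Subgroup.mem_top a') (Subgroup.mem_top b')
  have hfin : IsOfFinOrder ⁅a', b'⁆ :=
    Submonoid.isOfFinOrder_coe.2 (isOfFinOrder_of_finite (⟨_, hc⟩ : commutator N))
  have hfin' : IsOfFinOrder ⁅a, b⁆ := N.subtype.isOfFinOrder hfin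
  have : ⁅a, b⁆ = 1 := h _ (by
    rw [commutatorElement_def]
    exact mul_mem (mul_mem (mul_mem ha hb) (inv_mem ha)) (inv_mem hb)) hfin'
  exact commutatorElement_eq_one_iff_mul_comm.1 this

/-- Finite subsets of a torsion-free FC-centre have unique products. -/
theorem FCTorsionFree.exists_uniqueMul (h : FCTorsionFree G) {A B : Finset G}
    (hA : A.Nonempty) (hB : B.Nonempty) (hA' : ∀ a ∈ A, a ∈ fcCenter G)
    (hB' : ∀ a ∈ B, a ∈ fcCenter G) : ∃ a ∈ A, ∃ b ∈ B, UniqueMul A B a b := by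
  classical
  let N := Subgroup.closure ((A ∪ B : Finset G) : Set G)
  have hN : N ≤ fcCenter G := by
    rw [Subgroup.closure_le]
    intro x hx
    rcases Finset.mem_union.1 (Finset.mem_coe.1 hx) with hx | hx
    exacts [hA' x hx, hB' x hx]
  let : CommGroup N := { (inferInstance : Group N) with
    mul_comm := fun x y => Subtype.ext (h.commute (hN x.2) (hN y.2)) }
  have : Group.FG N := Group.closure_finset_fg _
  have : IsMulTorsionFree N := IsMulTorsionFree.of_not_isOfFinOrder fun x hx hx' =>
    hx (Subtype.ext (h x (hN x.2) (Submonoid.isOfFinOrder_coe.2 hx')))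
  have : Monoid.FG N := Group.fg_iff_monoid_fg.1 inferInstance
  have hAN : ∀ a ∈ A, a ∈ N := fun a ha => Subgroup.subset_closure (by simp [ha])
  have hBN : ∀ a ∈ B, a ∈ N := fun a ha => Subgroup.subset_closure (by simp [ha])
  obtain ⟨a, ha, b, hb, hu⟩ := UniqueProds.uniqueMul_of_nonempty
    (A := A.subtype (· ∈ N)) (B := B.subtype (· ∈ N))
    (hA.elim fun a ha => ⟨⟨a, hAN a ha⟩, by simpa using ha⟩)
    (hB.elim fun a ha => ⟨⟨a, hBN a ha⟩, by simpa using ha⟩)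
  refine ⟨a, by simpa using ha, b, by simpa using hb, fun x y hx hy hxy => ?_⟩
  have := @hu ⟨x, hAN x hx⟩ ⟨y, hBN y hy⟩ (by simpa using hx) (by simpa using hy)
    (Subtype.ext hxy)
  exact ⟨congrArg Subtype.val this.1, congrArg Subtype.val this.2⟩

end FC

/-! ### Homogeneous elements of crossed products -/

namespace CrossedProduct

section Single

variable {R : Type*} {G : Type*} [Ring R] [Group G] {d : CrossedSystem R G}

/-- The homogeneous element `a g`. -/
noncomputable def single (d : CrossedSystem R G) (g : G) (a : R) : CrossedProduct d :=
  ⟨Finsupp.single g a⟩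

theorem coeff_single (g : G) (a : R) : (single d g a).coeff = Finsupp.single g a := rfl

theorem single_mul_single (g h : G) (a b : R) :
    single d g a * single d h b = single d (g * h) (a * d.act g b * (d.twist g h : R)) := by
  ext1
  exact d.mulCoeff_single g h a b

theorem one_eq_single : (1 : CrossedProduct d) = single d 1 (((d.twist 1 1)⁻¹ : Rˣ) : R) := rfl

theorem coeff_sub (x y : CrossedProduct d) : (x - y).coeff = x.coeff - y.coeff := by
  rw [sub_eq_add_neg, coeff_add, coeff_neg, ← sub_eq_add_neg]

theorem coeff_sum {α : Type*} (s : Finset α) (f : α → CrossedProduct d) :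
    (∑ i ∈ s, f i).coeff = ∑ i ∈ s, (f i).coeff :=
  map_sum (AddMonoidHom.mk' (coeff : CrossedProduct d → G →₀ R) coeff_add) f s

@[elab_as_elim]
theorem induction_linear {p : CrossedProduct d → Prop} (x : CrossedProduct d) (zero : p 0)
    (add : ∀ x y, p x → p y → p (x + y)) (single : ∀ g a, p (single d g a)) : p x := by
  obtain ⟨x⟩ := x
  induction x using Finsupp.induction_linear with
  | zero => exact zero
  | add x y hx hy => exact add _ _ hx hy
  | single g a => exact single g a

theorem coeff_mul_apply (x y : CrossedProduct d) (z : G) : (x * y).coeff z =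
    ∑ g ∈ x.coeff.support, ∑ h ∈ y.coeff.support,
      Finsupp.single (g * h) (x.coeff g * d.act g (y.coeff h) * (d.twist g h : R)) z := by
  rw [coeff_mul, CrossedSystem.mulCoeff]
  simp only [Finsupp.sum, Finsupp.finsetSum_apply]

theorem exists_of_coeff_mul_ne_zero {x y : CrossedProduct d} {z : G} (h : (x * y).coeff z ≠ 0) :
    ∃ g, x.coeff g ≠ 0 ∧ ∃ g', y.coeff g' ≠ 0 ∧ g * g' = z := by
  rw [coeff_mul_apply] at h
  obtain ⟨g, hg, h⟩ := Finset.exists_ne_zero_of_sum_ne_zero h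
  obtain ⟨g', hg', h⟩ := Finset.exists_ne_zero_of_sum_ne_zero h
  refine ⟨g, Finsupp.mem_support_iff.1 hg, g', Finsupp.mem_support_iff.1 hg', ?_⟩
  by_contra hne
  exact h (Finsupp.single_eq_of_ne (Ne.symm hne))

theorem coeff_mul_of_unique {x y : CrossedProduct d} {g₀ h₀ : G}
    (h : ∀ g h, x.coeff g ≠ 0 → y.coeff h ≠ 0 → g * h = g₀ * h₀ → g = g₀ ∧ h = h₀) :
    (x * y).coeff (g₀ * h₀) = x.coeff g₀ * d.act g₀ (y.coeff h₀) * (d.twist g₀ h₀ : R) := by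
  rw [coeff_mul_apply, Finset.sum_eq_single g₀, Finset.sum_eq_single h₀, Finsupp.single_eq_same]
  · intro h' hh' hne
    refine Finsupp.single_eq_of_ne fun heq => hne ?_
    exact mul_left_cancel heq.symm
  · intro hh
    rw [Finsupp.notMem_support_iff.1 hh]
    simp
  · intro g hg hne
    refine Finset.sum_eq_zero fun h' hh' => Finsupp.single_eq_of_ne fun heq => hne ?_
    exact (h g h' (Finsupp.mem_support_iff.1 hg) (Finsupp.mem_support_iff.1 hh') heq.symm).1
  · intro hg
    rw [Finsupp.notMem_support_iff.1 hg]
    simp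

/-- A right inverse `b` and a left inverse `b'` are solved for separately and must agree. The
inverse is recorded as homogeneous so that supports can be tracked under conjugation. -/
theorem exists_unit (d : CrossedSystem R G) (g : G) (a : Rˣ) : ∃ U : (CrossedProduct d)ˣ,
    (U : CrossedProduct d) = single d g a ∧ ∃ b, ((U⁻¹ : _ˣ) : CrossedProduct d) = single d g⁻¹ b := by
  let b : R := (d.act g).symm
    ((a⁻¹ : Rˣ) * ((d.twist 1 1)⁻¹ : Rˣ) * ((d.twist g g⁻¹)⁻¹ : Rˣ))
  let b' : R := ((d.twist 1 1)⁻¹ : Rˣ) * ((d.twist g⁻¹ g)⁻¹ : Rˣ) * d.act g⁻¹ (a⁻¹ : Rˣ)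
  have h1 : single d g a * single d g⁻¹ b = 1 := by
    rw [single_mul_single, one_eq_single, mul_inv_cancel]
    congr 1
    simp [b, mul_assoc]
  have h2 : single d g⁻¹ b' * single d g a = 1 := by
    rw [single_mul_single, one_eq_single, inv_mul_cancel]
    congr 1
    change (((d.twist 1 1)⁻¹ : Rˣ) : R) * ((d.twist g⁻¹ g)⁻¹ : Rˣ) * d.act g⁻¹ (a⁻¹ : Rˣ) *
      d.act g⁻¹ a * (d.twist g⁻¹ g : R) = ((d.twist 1 1)⁻¹ : Rˣ)
    rw [mul_assoc _ (d.act g⁻¹ ((a⁻¹ : Rˣ) : R)), ← map_mul, Units.inv_mul, map_one, mul_one, mul_assoc,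
      Units.inv_mul, mul_one]
  rw [left_inv_eq_right_inv h2 h1] at h2
  exact ⟨⟨_, _, h1, h2⟩, rfl, b, rfl⟩

end Single

/-! ### Crossed products of skew fields are prime if the FC-centre is torsion-free -/

section Prime

variable {k : Type*} {G : Type*} [DivisionRing k] [Group G] {d : CrossedSystem k G}

open Classical in
/-- The projection onto the FC-centre. -/
noncomputable def fcProj (x : CrossedProduct d) : CrossedProduct d :=
  ⟨x.coeff.filter (· ∈ fcCenter G)⟩

theorem fcProj_coeff_of_mem (x : CrossedProduct d) {g : G} (hg : g ∈ fcCenter G) :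
    (fcProj x).coeff g = x.coeff g := by
  classical
  exact Finsupp.filter_apply_pos _ _ hg

theorem fcProj_coeff_ne_zero {x : CrossedProduct d} {g : G} (h : (fcProj x).coeff g ≠ 0) :
    g ∈ fcCenter G ∧ x.coeff g ≠ 0 := by
  classical
  have hg : g ∈ fcCenter G := by
    by_contra hg
    exact h (Finsupp.filter_apply_neg _ _ hg)
  rw [fcProj_coeff_of_mem x hg] at h
  exact ⟨hg, h⟩

theorem fcProj_sub (x y : CrossedProduct d) : fcProj (x - y) = fcProj x - fcProj y := by
  classical
  ext1
  rw [coeff_sub, fcProj, coeff_sub]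
  exact Finsupp.filter_sub (· ∈ fcCenter G) x.coeff y.coeff

theorem coeff_conj_ne_zero {g : G} {U : (CrossedProduct d)ˣ} {c : k} {y : CrossedProduct d} {h : G}
    (hU : (U : CrossedProduct d) = single d g 1)
    (hc : ((U⁻¹ : (CrossedProduct d)ˣ) : CrossedProduct d) = single d g⁻¹ c)
    (hh : (((U⁻¹ : (CrossedProduct d)ˣ) : CrossedProduct d) * y * U).coeff h ≠ 0) :
    y.coeff (g * h * g⁻¹) ≠ 0 := by
  obtain ⟨h₁, hh₁, h₂, hh₂, rfl⟩ := exists_of_coeff_mul_ne_zero hh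
  obtain ⟨h₃, hh₃, h₄, hh₄, rfl⟩ := exists_of_coeff_mul_ne_zero hh₁
  rw [hU, coeff_single, Finsupp.single_apply_ne_zero] at hh₂
  rw [hc, coeff_single, Finsupp.single_apply_ne_zero] at hh₃
  rw [hh₂.1, hh₃.1]
  convert hh₄ using 2
  group

theorem exists_coeff_ne_zero {x : CrossedProduct d} (h : x ≠ 0) : ∃ g, x.coeff g ≠ 0 := by
  by_contra! h0
  exact h (CrossedProduct.ext (Finsupp.ext h0))

/-- A finite-index subgroup is not covered by finitely many cosets of infinite-index subgroups. -/
theorem _root_.Subgroup.exists_finiteIndex_of_subset_leftCosets {G : Type*} [Group G]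
    (D : Subgroup G) [D.FiniteIndex] {α : Type*} (s : Finset α) (t : α → G) (H : α → Subgroup G)
    (h : ∀ x ∈ D, ∃ i ∈ s, (t i)⁻¹ * x ∈ H i) : ∃ i ∈ s, (H i).FiniteIndex := by
  classical
  have : Fintype (G ⧸ D) := Fintype.ofFinite _
  -- Translating the cover of `D` by representatives of `G ⧸ D` covers all of `G`, where Neumann's
  -- lemma applies.
  obtain ⟨⟨q, i⟩, hi, hf⟩ := Subgroup.exists_finiteIndex_of_leftCoset_cover
    (s := (Finset.univ : Finset (G ⧸ D)) ×ˢ s) (g := fun p => p.1.out * t p.2)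
    (H := fun p => H p.2) (by
      rw [Set.eq_univ_iff_forall]
      intro x
      have hx : (QuotientGroup.mk x : G ⧸ D).out⁻¹ * x ∈ D := by
        rw [← QuotientGroup.eq, QuotientGroup.out_eq']
      obtain ⟨i, hi, hx⟩ := h _ hx
      refine Set.mem_iUnion₂.2 ⟨(QuotientGroup.mk x, i), by simp [hi], ?_⟩
      rw [mem_leftCoset_iff]
      simpa [mul_assoc] using hx)
  exact ⟨i, (Finset.mem_product.1 hi).2, hf⟩

/-- The minimal-support argument: if `x` is nonzero and `x r b = 0` for all `r`, then there is
another such `x` whose projection to the FC-centre is nonzero and commutes with the group elements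
centralizing its support. -/
theorem exists_fcProj_commute {b x : CrossedProduct d} (hx0 : x ≠ 0) (hx : ∀ r, x * r * b = 0) :
    ∃ α : CrossedProduct d, (∀ r, α * r * b = 0) ∧ fcProj α ≠ 0 ∧
      ∀ (g : G) (U : (CrossedProduct d)ˣ), (U : CrossedProduct d) = single d g 1 →
        (∃ c, ((U⁻¹ : _ˣ) : CrossedProduct d) = single d g⁻¹ c) →
        (∀ h, (fcProj α).coeff h ≠ 0 → h * g = g * h) →
        fcProj (((U⁻¹ : (CrossedProduct d)ˣ) : CrossedProduct d) * α * (U : CrossedProduct d)) =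
          fcProj α := by
  classical
  have hex : ∃ n, ∃ α : CrossedProduct d, (∀ r, α * r * b = 0) ∧ fcProj α ≠ 0 ∧
      (fcProj α).coeff.support.card = n := by
    obtain ⟨g, hg⟩ := exists_coeff_ne_zero hx0
    refine ⟨_, x * single d g⁻¹ 1, fun r => by rw [mul_assoc x]; exact hx _, fun h => ?_, rfl⟩
    have h1 : (x * single d g⁻¹ 1).coeff 1 ≠ 0 := by
      rw [← mul_inv_cancel g, coeff_mul_of_unique]
      · rw [coeff_single, Finsupp.single_eq_same, map_one, mul_one]
        exact mul_ne_zero hg (Units.ne_zero _)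
      · intro g₁ h₁ _ hh heq
        rw [coeff_single, Finsupp.single_apply_ne_zero] at hh
        obtain ⟨rfl, -⟩ := hh
        exact ⟨mul_right_cancel heq, rfl⟩
    exact h1 (by rw [← fcProj_coeff_of_mem _ (one_mem _), h, coeff_zero, Finsupp.zero_apply])
  obtain ⟨α₀, hα₀, hne, hcard⟩ := Nat.find_spec hex
  have hmin : ∀ β : CrossedProduct d, (∀ r, β * r * b = 0) →
      (fcProj β).coeff.support.card < (fcProj α₀).coeff.support.card → fcProj β = 0 := by
    intro β hβ hlt
    by_contra h
    exact Nat.find_min hex (hcard ▸ hlt) ⟨β, hβ, h, rfl⟩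
  obtain ⟨g, hg⟩ := exists_coeff_ne_zero hne
  obtain ⟨hgm, hg'⟩ := fcProj_coeff_ne_zero hg
  obtain ⟨U₀, hU₀, c₀, hc₀⟩ := exists_unit d g (Units.mk0 _ hg')
  rw [Units.val_mk0] at hU₀
  -- Dividing a minimal `α₀` by one of its FC terms gives `α` the same coefficient at `1` as the
  -- unit of the ring, without enlarging the support of its projection.
  let α := α₀ * ((U₀⁻¹ : (CrossedProduct d)ˣ) : CrossedProduct d)
  have hα : ∀ r, α * r * b = 0 := fun r => by rw [mul_assoc α₀]; exact hα₀ _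
  have hα1 : (α - 1).coeff 1 = 0 := by
    have : α - 1 = (α₀ - single d g (α₀.coeff g)) * single d g⁻¹ c₀ := by
      rw [sub_mul, ← hU₀, ← hc₀, Units.mul_inv]
    rw [this]
    by_contra h
    obtain ⟨h₁, hh₁, h₂, hh₂, heq⟩ := exists_of_coeff_mul_ne_zero h
    rw [coeff_single, Finsupp.single_apply_ne_zero] at hh₂
    obtain ⟨rfl, -⟩ := hh₂
    rw [mul_inv_eq_one] at heq
    subst heq
    rw [coeff_sub, coeff_single, Finsupp.sub_apply, Finsupp.single_eq_same, sub_self] at hh₁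
    exact hh₁ rfl
  have h1α : (fcProj α).coeff 1 ≠ 0 := by
    rw [coeff_sub, Finsupp.sub_apply, sub_eq_zero] at hα1
    rw [fcProj_coeff_of_mem _ (one_mem _), hα1, one_eq_single, coeff_single,
      Finsupp.single_eq_same]
    exact Units.ne_zero _
  have hcardα : (fcProj α).coeff.support.card ≤ (fcProj α₀).coeff.support.card := by
    refine (Finset.card_le_card (t := (fcProj α₀).coeff.support.image (· * g⁻¹)) ?_).trans
      Finset.card_image_le
    intro h hh
    obtain ⟨hhm, hh⟩ := fcProj_coeff_ne_zero (Finsupp.mem_support_iff.1 hh)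
    obtain ⟨h₁, hh₁, h₂, hh₂, heq⟩ := exists_of_coeff_mul_ne_zero hh
    rw [hc₀, coeff_single, Finsupp.single_apply_ne_zero] at hh₂
    obtain ⟨rfl, -⟩ := hh₂
    refine Finset.mem_image.2 ⟨h₁, Finsupp.mem_support_iff.2 ?_, heq⟩
    rwa [fcProj_coeff_of_mem]
    rw [show h₁ = h * g by rw [← heq, inv_mul_cancel_right]]
    exact mul_mem hhm hgm
  refine ⟨α, hα, fun h => h1α (by rw [h, coeff_zero, Finsupp.zero_apply]), ?_⟩
  rintro x U hU ⟨c, hc⟩ hcomm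
  -- Conjugation adds nothing to the FC part of the support, which is centralized, and the
  -- coefficients at `1` cancel. So the projection of `β` has smaller support and vanishes by
  -- minimality.
  let β := ((U⁻¹ : (CrossedProduct d)ˣ) : CrossedProduct d) * α * U - α
  have hβ : ∀ r, β * r * b = 0 := fun r => by
    have h1 : ((U⁻¹ : (CrossedProduct d)ˣ) : CrossedProduct d) * α * U * r * b
        = (U⁻¹ : (CrossedProduct d)ˣ) * (α * (U * r) * b) := by simp only [mul_assoc]
    rw [sub_mul, sub_mul, hα, h1, hα, mul_zero, sub_zero]
  rw [← sub_eq_zero, ← fcProj_sub]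
  refine hmin β hβ (lt_of_lt_of_le (Finset.card_lt_card ?_) hcardα)
  refine (Finset.ssubset_iff_of_subset fun h hh => ?_).2 ⟨1, Finsupp.mem_support_iff.2 h1α, ?_⟩
  · obtain ⟨hm, hh⟩ := fcProj_coeff_ne_zero (Finsupp.mem_support_iff.1 hh)
    rw [Finsupp.mem_support_iff]
    by_cases hαh : α.coeff h = 0
    · rw [coeff_sub, Finsupp.sub_apply, hαh, sub_zero] at hh
      have h1 := coeff_conj_ne_zero hU hc hh
      rw [← fcProj_coeff_of_mem _ (fcCenter_normal.conj_mem h hm x)] at h1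
      have h2 := hcomm _ h1
      rw [inv_mul_cancel_right, mul_right_inj] at h2
      rwa [← h2] at h1
    · rwa [fcProj_coeff_of_mem _ hm]
  · rw [Finsupp.notMem_support_iff, fcProj_coeff_of_mem _ (one_mem _)]
    have : β = ((U⁻¹ : (CrossedProduct d)ˣ) : CrossedProduct d) * (α - 1) * U - (α - 1) := by
      rw [mul_sub, sub_mul, mul_one, Units.inv_mul]
      simp only [β]
      abel
    rw [this, coeff_sub, Finsupp.sub_apply, hα1, sub_zero]
    by_contra h
    have := coeff_conj_ne_zero hU hc h
    rw [mul_one, mul_inv_cancel] at this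
    exact this hα1

/-- Suppose `z` is in the support of `fcProj α * b`, and let `x` centralize the support of `fcProj
α`. The conjugate `γ` of `α` by `x` has the same projection and kills `b`, so the non-FC part of `γ`
must produce `z = h w` with `w` in the support of `b` and `x h x⁻¹` in that of `α`. Hence `x` lies
in one of finitely many cosets of centralizers of non-FC elements `z w⁻¹`. These would cover a
subgroup of finite index, contrary to Neumann's lemma. -/
theorem fcProj_mul_eq_zero {b α : CrossedProduct d} (hα : ∀ r, α * r * b = 0)
    (hc : ∀ (g : G) (U : (CrossedProduct d)ˣ), (U : CrossedProduct d) = single d g 1 →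
        (∃ c, ((U⁻¹ : _ˣ) : CrossedProduct d) = single d g⁻¹ c) →
        (∀ h, (fcProj α).coeff h ≠ 0 → h * g = g * h) →
        fcProj (((U⁻¹ : (CrossedProduct d)ˣ) : CrossedProduct d) * α * (U : CrossedProduct d)) =
          fcProj α) : fcProj α * b = 0 := by
  classical
  by_contra hne
  obtain ⟨z, hz⟩ := exists_coeff_ne_zero hne
  let D : Subgroup G := ⨅ h ∈ (fcProj α).coeff.support, Subgroup.centralizer {h}
  have hD : D.FiniteIndex := Subgroup.finiteIndex_iInf' _ fun h hh =>
    (fcProj_coeff_ne_zero (Finsupp.mem_support_iff.1 hh)).1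
  -- For a pair `(g, w)`, all elements conjugating `z w⁻¹` to `g` form one left coset of its
  -- centralizer; `t` picks a representative, with default `1` if there is none.
  let t : G × G → G := fun p =>
    if h : ∃ x, x * (z * p.2⁻¹) * x⁻¹ = p.1 then h.choose else 1
  obtain ⟨⟨g, w⟩, hgw, hfi⟩ := D.exists_finiteIndex_of_subset_leftCosets
    ((α.coeff.support ×ˢ b.coeff.support).filter fun p => z * p.2⁻¹ ∉ fcCenter G) t
    (fun p => Subgroup.centralizer {z * p.2⁻¹}) (by
      intro x hx
      obtain ⟨U, hU, c, hc'⟩ := exists_unit d x 1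
      rw [Units.val_one] at hU
      let γ := ((U⁻¹ : (CrossedProduct d)ˣ) : CrossedProduct d) * α * U
      have hγ : fcProj γ = fcProj α := hc x U hU ⟨c, hc'⟩ fun h hh => by
        have := (Subgroup.mem_iInf.1 (Subgroup.mem_iInf.1 hx h)) (Finsupp.mem_support_iff.2 hh)
        rw [Subgroup.mem_centralizer_singleton_iff] at this
        exact this.symm
      have hγb : γ * b = 0 := by
        have : γ * b = (U⁻¹ : (CrossedProduct d)ˣ) * (α * U * b) := by simp only [γ, mul_assoc]
        rw [this, hα, mul_zero]
      have hz' : ((γ - fcProj α) * b).coeff z ≠ 0 := by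
        rw [sub_mul, hγb, zero_sub, coeff_neg, Finsupp.neg_apply]
        exact neg_ne_zero.2 hz
      obtain ⟨h, hh, w, hw, heq⟩ := exists_of_coeff_mul_ne_zero hz'
      have hhw : h = z * w⁻¹ := by rw [← heq, mul_inv_cancel_right]
      rw [← hγ, coeff_sub, Finsupp.sub_apply] at hh
      have hhm : h ∉ fcCenter G := fun hm => hh (by rw [fcProj_coeff_of_mem _ hm, sub_self])
      have h0 : (fcProj γ).coeff h = 0 := by
        by_contra h0
        exact hhm (fcProj_coeff_ne_zero h0).1
      rw [h0, sub_zero] at hh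
      have hconj := coeff_conj_ne_zero hU hc' hh
      refine ⟨(x * h * x⁻¹, w), ?_, ?_⟩
      · simp only [Finset.mem_filter, Finset.mem_product, Finsupp.mem_support_iff]
        exact ⟨⟨hconj, hw⟩, hhw ▸ hhm⟩
      · have hex : ∃ y, y * (z * w⁻¹) * y⁻¹ = x * h * x⁻¹ := ⟨x, by rw [hhw]⟩
        have ht : t (x * h * x⁻¹, w) = hex.choose := dif_pos hex
        have hs := hex.choose_spec
        rw [ht, Subgroup.mem_centralizer_singleton_iff]
        generalize hex.choose = y at hs
        rw [← hhw] at hs ⊢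
        calc y⁻¹ * x * h = y⁻¹ * (x * h * x⁻¹) * x := by group
          _ = h * (y⁻¹ * x) := by rw [← hs]; group)
  exact (Finset.mem_filter.1 hgw).2 hfi

theorem isPrimeRing_of_fcTorsionFree (hG : FCTorsionFree G) : IsPrimeRing (CrossedProduct d) := by
  refine isPrimeRing_of_forall fun x b₀ hx => ?_
  by_contra! hne
  obtain ⟨g, hg⟩ := exists_coeff_ne_zero hne.2
  obtain ⟨V, hV, -⟩ := exists_unit d g⁻¹ 1
  let b := (V : CrossedProduct d) * b₀
  have hb1 : b.coeff 1 ≠ 0 := by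
    rw [show b = single d g⁻¹ 1 * b₀ by rw [← Units.val_one, ← hV], ← inv_mul_cancel g,
      coeff_mul_of_unique]
    · rw [coeff_single, Finsupp.single_eq_same, one_mul]
      exact mul_ne_zero (by simpa using hg) (Units.ne_zero _)
    · intro g₁ h₁ hg₁ _ heq
      rw [coeff_single, Finsupp.single_apply_ne_zero] at hg₁
      obtain ⟨rfl, -⟩ := hg₁
      exact ⟨rfl, mul_left_cancel heq⟩
  obtain ⟨α, hα, hα0, hc⟩ := exists_fcProj_commute (b := b) hne.1 fun r => by
    rw [← mul_assoc, mul_assoc x]; exact hx _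
  have h0 := fcProj_mul_eq_zero hα hc
  have hbp : fcProj b ≠ 0 := fun h => hb1 (by
    rw [← fcProj_coeff_of_mem b (one_mem _), h, coeff_zero, Finsupp.zero_apply])
  have hmem : ∀ (y : CrossedProduct d), ∀ a ∈ (fcProj y).coeff.support, a ∈ fcCenter G :=
    fun y a ha => (fcProj_coeff_ne_zero (Finsupp.mem_support_iff.1 ha)).1
  have hnonempty : ∀ y : CrossedProduct d, y ≠ 0 → y.coeff.support.Nonempty := fun y hy =>
    Finsupp.support_nonempty_iff.2 fun h => hy (CrossedProduct.ext h)
  obtain ⟨p, hp, q, hq, hu⟩ := hG.exists_uniqueMul (hnonempty _ hα0) (hnonempty _ hbp)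
    (hmem _) (hmem _)
  -- The right factor may be `b` instead of `fcProj b`: if `g` and `g h` lie in the FC-centre, so
  -- does `h`.
  have hpq := coeff_mul_of_unique (x := fcProj α) (y := b) (g₀ := p) (h₀ := q) fun g h hg hh heq =>
    hu (Finsupp.mem_support_iff.2 hg) (Finsupp.mem_support_iff.2 (by
      rwa [fcProj_coeff_of_mem]
      rw [show h = g⁻¹ * (p * q) by rw [← heq, inv_mul_cancel_left]]
      exact mul_mem (inv_mem (fcProj_coeff_ne_zero hg).1) (mul_mem (hmem _ p hp) (hmem _ q hq))))
      heq
  rw [h0, coeff_zero, Finsupp.zero_apply] at hpq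
  have hq' := (fcProj_coeff_ne_zero (Finsupp.mem_support_iff.1 hq)).2
  refine mul_ne_zero (mul_ne_zero (Finsupp.mem_support_iff.1 hp) ?_) (Units.ne_zero _) hpq.symm
  simpa using hq'

end Prime

end CrossedProduct

/-! ### Finite-index normal subgroups and crossed products -/

namespace CrossedProduct

section Incl

variable {R : Type*} {G : Type*} [Ring R] [Group G] (d : CrossedSystem R G) (K : Subgroup G)

theorem incl_single (κ : K) (a : R) :
    incl d K (single (d.restrict K) κ a) = single d κ a := by
  ext1
  exact Finsupp.mapDomain_single

theorem coeff_incl (x : CrossedProduct (d.restrict K)) (κ : K) :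
    (incl d K x).coeff κ = x.coeff κ :=
  Finsupp.mapDomain_apply K.subtype_injective _ _

theorem mem_of_coeff_incl_ne_zero (x : CrossedProduct (d.restrict K)) {g : G}
    (h : (incl d K x).coeff g ≠ 0) : g ∈ K := by
  by_contra hg
  exact h (Finsupp.mapDomain_of_notMem_range _ _ fun ⟨κ, hκ⟩ => hg (hκ ▸ κ.2))

theorem incl_injective : Function.Injective (incl d K) := fun x y h => by
  ext κ
  rw [← coeff_incl, h, coeff_incl]

variable {d K}

theorem single_eq_single_mul {g h t : G} (b : R) (hg : g = h * t) :
    single d g b = single d h (b * ((d.twist h t)⁻¹ : Rˣ)) * single d t 1 := by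
  rw [single_mul_single, map_one, mul_one, mul_assoc, Units.inv_mul, mul_one, hg]

theorem single_eq_single_mul' {g h t : G} (b : R) (hg : g = t * h) :
    single d g b = single d t 1 *
      single d h ((d.act t).symm (b * ((d.twist t h)⁻¹ : Rˣ))) := by
  rw [single_mul_single, one_mul, RingEquiv.apply_symm_apply, mul_assoc, Units.inv_mul, mul_one, hg]

theorem exists_single_mul_incl [K.Normal] (t : G) (r : CrossedProduct (d.restrict K)) :
    ∃ r', single d t 1 * incl d K r = incl d K r' * single d t 1 := by
  induction r using induction_linear with
  | zero => exact ⟨0, by simp⟩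
  | add x y hx hy =>
    obtain ⟨x', hx⟩ := hx
    obtain ⟨y', hy⟩ := hy
    exact ⟨x' + y', by rw [map_add, mul_add, hx, hy, map_add, add_mul]⟩
  | single κ a =>
    rw [incl_single, single_mul_single, single_eq_single_mul (h := t * κ * t⁻¹) (t := t) _ (by group)]
    exact ⟨_, by rw [← incl_single d K ⟨t * κ * t⁻¹, ‹K.Normal›.conj_mem _ κ.2 t⟩]⟩

theorem exists_incl_mul_single [K.Normal] (t : G) (r : CrossedProduct (d.restrict K)) :
    ∃ r', incl d K r * single d t 1 = single d t 1 * incl d K r' := by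
  induction r using induction_linear with
  | zero => exact ⟨0, by simp⟩
  | add x y hx hy =>
    obtain ⟨x', hx⟩ := hx
    obtain ⟨y', hy⟩ := hy
    exact ⟨x' + y', by rw [map_add, add_mul, hx, hy, map_add, mul_add]⟩
  | single κ a =>
    rw [incl_single, single_mul_single, single_eq_single_mul' (h := t⁻¹ * κ * t) (t := t) _ (by group)]
    exact ⟨_, by rw [← incl_single d K ⟨t⁻¹ * κ * t, by
      simpa using ‹K.Normal›.conj_mem _ κ.2 t⁻¹⟩]⟩

theorem exists_eq_sum_incl_mul [K.Normal] [Fintype (G ⧸ K)] (x : CrossedProduct d) :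
    ∃ c : G ⧸ K → CrossedProduct (d.restrict K), ∑ j, incl d K (c j) * single d j.out 1 = x := by
  classical
  induction x using induction_linear with
  | zero => exact ⟨0, by simp⟩
  | add x y hx hy =>
    obtain ⟨c, rfl⟩ := hx
    obtain ⟨c', rfl⟩ := hy
    exact ⟨c + c', by simp [add_mul, Finset.sum_add_distrib]⟩
  | single g b =>
    let j : G ⧸ K := QuotientGroup.mk g
    -- Quotient classes are left cosets, whereas the expansion uses right cosets; normality
    -- identifies them.
    have hj : g * j.out⁻¹ ∈ K := by
      rw [‹K.Normal›.mem_comm_iff, ← QuotientGroup.eq, QuotientGroup.out_eq']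
    refine ⟨Pi.single j (single (d.restrict K) ⟨g * j.out⁻¹, hj⟩
      (b * ((d.twist (g * j.out⁻¹) j.out)⁻¹ : Rˣ))), ?_⟩
    rw [Finset.sum_eq_single j, Pi.single_eq_same, incl_single,
      single_eq_single_mul (h := g * j.out⁻¹) (t := j.out) b (by group)]
    · intro i _ hi
      rw [Pi.single_eq_of_ne hi, map_zero, zero_mul]
    · simp

/-- The summands have supports in distinct cosets `K j.out`, so the coefficient at `κ j.out`
involves only `c j`. -/
theorem eq_zero_of_sum_incl_mul_eq_zero [Nontrivial R] [K.Normal] [Fintype (G ⧸ K)]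
    {c : G ⧸ K → CrossedProduct (d.restrict K)}
    (h : ∑ j, incl d K (c j) * single d j.out 1 = 0) (j : G ⧸ K) : c j = 0 := by
  ext κ
  rw [coeff_zero, Finsupp.zero_apply]
  have h0 := DFunLike.congr_fun (congrArg coeff h) ((κ : G) * j.out)
  rw [coeff_sum, Finsupp.finsetSum_apply, Finset.sum_eq_single j, coeff_mul_of_unique, coeff_incl,
    coeff_single, Finsupp.single_eq_same, map_one, mul_one, coeff_zero, Finsupp.zero_apply] at h0
  · exact (Units.mul_left_eq_zero _).1 h0
  · intro g₁ h₁ _ hh heq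
    rw [coeff_single, Finsupp.single_apply_ne_zero] at hh
    obtain ⟨rfl, -⟩ := hh
    exact ⟨mul_right_cancel heq, rfl⟩
  · intro i _ hi
    by_contra hne
    obtain ⟨g₁, hg₁, g₂, hg₂, heq⟩ := exists_of_coeff_mul_ne_zero hne
    rw [coeff_single, Finsupp.single_apply_ne_zero] at hg₂
    obtain ⟨rfl, -⟩ := hg₂
    refine hi ?_
    rw [← QuotientGroup.out_eq' i, ← QuotientGroup.out_eq' j, QuotientGroup.eq]
    have : j.out = (κ : G)⁻¹ * (g₁ * i.out) := by rw [heq, inv_mul_cancel_left]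
    rw [this]
    simpa [mul_assoc] using ‹K.Normal›.conj_mem _
      (mul_mem (inv_mem κ.2) (mem_of_coeff_incl_ne_zero d K _ hg₁)) i.out⁻¹
  · intro hj
    exact absurd (Finset.mem_univ j) hj

theorem exists_isNormalizingBasis [Nontrivial R] (d : CrossedSystem R G) (K : Subgroup G)
    [K.Normal] [Fintype (G ⧸ K)] :
    ∃ u : G ⧸ K → (CrossedProduct d)ˣ, IsNormalizingBasis (incl d K) u := by
  choose u hu _ using fun j : G ⧸ K => exists_unit d j.out 1
  simp only [Units.val_one] at hu
  refine ⟨u, incl_injective d K, fun j r => ?_, fun j r => ?_, fun c c' h => ?_, fun x => ?_⟩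
  · rw [hu]; exact exists_single_mul_incl _ _
  · rw [hu]; exact exists_incl_mul_single _ _
  · simp only [hu] at h
    funext j
    rw [← sub_eq_zero]
    refine eq_zero_of_sum_incl_mul_eq_zero (c := c - c') ?_ j
    simp only [Pi.sub_apply, map_sub, sub_mul, Finset.sum_sub_distrib, h, sub_self]
  · simp only [hu]
    exact exists_eq_sum_incl_mul x

instance [Nontrivial R] : Nontrivial (CrossedProduct d) :=
  ⟨0, 1, fun h => Units.ne_zero (d.twist 1 1)⁻¹ (by
    have := DFunLike.congr_fun (congrArg coeff h) 1
    rw [one_eq_single, coeff_single, Finsupp.single_eq_same] at this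
    exact this.symm)⟩

end Incl

end CrossedProduct

/-! ### The main theorem -/

/-- Composing with `σ⁻¹` makes the fraction ring of `A` a fraction ring of `B`. This identifies `k *
L` with its copy inside `k * H`, which is built from `L.subgroupOf H`. -/
theorem oreDim_congr {A B : Type*} [Ring A] [Ring B] (σ : A ≃+* B) (N : Type*) [AddCommGroup N]
    [Module A N] [Module B N] (h : ∀ (a : A) (n : N), a • n = σ a • n) (hp : IsPrimeRing A)
    (hA : IsLeftGoldie A) : oreDim A N = oreDim B N := by
  obtain ⟨_⟩ := hA.nonempty_oreSet hp
  have hmem : ∀ {b : B}, σ.symm b ∈ A⁰ ↔ b ∈ B⁰ := fun {b} => by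
    have h0 : ∀ x : B, σ.symm x = 0 ↔ x = 0 := fun x => map_eq_zero_iff _ σ.symm.injective
    simp only [mem_nonZeroDivisors_iff, σ.symm.surjective.forall, ← map_mul, h0]
  have hf := IsLeftFractionRing.of_ore (R := A)
  have hφ : IsFractionModule (OreLocalization.numeratorRingHom (R := A) (S := A⁰))
      (OreLocalization.moduleHom A⁰ N) :=
    { map_smul := OreLocalization.moduleHom_smul _
      surj := OreLocalization.exists_smul_eq_moduleHom _
      ker := fun _ => OreLocalization.moduleHom_eq_zero _ }
  have hf' : IsLeftFractionRing
      ((OreLocalization.numeratorRingHom (R := A) (S := A⁰)).comp (σ.symm : B →+* A)) :=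
    { injective := hf.injective.comp σ.symm.injective
      isUnit := fun s hs => hf.isUnit _ (hmem.2 hs)
      surj := fun q => by
        obtain ⟨s, hs, r, h⟩ := hf.surj q
        exact ⟨σ s, hmem.1 (by simpa using hs), σ r, by simpa using h⟩ }
  have hφ' : IsFractionModule
      ((OreLocalization.numeratorRingHom (R := A) (S := A⁰)).comp (σ.symm : B →+* A))
      (OreLocalization.moduleHom A⁰ N) :=
    { map_smul := fun b n => by
        obtain ⟨a, rfl⟩ := σ.surjective b
        rw [← h, hφ.map_smul]
        simp
      surj := fun q => by
        obtain ⟨s, hs, n, h⟩ := hφ.surj q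
        exact ⟨σ s, hmem.1 (by simpa using hs), n, by simpa using h⟩
      ker := fun n hn => by
        obtain ⟨s, hs, h'⟩ := hφ.ker n hn
        exact ⟨σ s, hmem.1 (by simpa using hs), by rw [← h, h']⟩ }
  rw [oreDim_eq hf hφ, oreDim_eq hf' hφ']

section Main

open CrossedProduct

variable {k : Type*} [DivisionRing k]

theorem oreDimRes_div_index {H : Type*} [Group H] (d : CrossedSystem k H) (K : Subgroup H)
    [K.Normal] [K.FiniteIndex] (hp : IsPrimeRing (CrossedProduct (d.restrict K)))
    (hK : IsLeftGoldie (CrossedProduct (d.restrict K))) (hp' : IsPrimeRing (CrossedProduct d))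
    (N : Type*) [AddCommGroup N] [Module (CrossedProduct d) N] :
    oreDimRes (incl d K) N / (K.index : ℝ≥0∞) = oreDim (CrossedProduct d) N := by
  have : Fintype (H ⧸ K) := Fintype.ofFinite _
  obtain ⟨u, hu⟩ := exists_isNormalizingBasis d K
  let : Module (CrossedProduct (d.restrict K)) N := Module.compHom N (incl d K)
  rw [Subgroup.index, Nat.card_eq_fintype_card]
  exact hu.oreDim_div_card hp hK hp' N fun _ _ => rfl

theorem isPrimeRing_and_isLeftGoldie {H : Type*} [Group H] (d : CrossedSystem k H)
    (K : Subgroup H) [K.Normal] [K.FiniteIndex] (hH : deltaPlus H = ⊥)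
    (hg : IsLeftGoldie (CrossedProduct d)) :
    IsPrimeRing (CrossedProduct d) ∧ IsPrimeRing (CrossedProduct (d.restrict K)) ∧
      IsLeftGoldie (CrossedProduct (d.restrict K)) := by
  have : Fintype (H ⧸ K) := Fintype.ofFinite _
  obtain ⟨u, hu⟩ := exists_isNormalizingBasis d K
  have ht := fcTorsionFree_of_deltaPlus_eq_bot hH
  exact ⟨isPrimeRing_of_fcTorsionFree ht, isPrimeRing_of_fcTorsionFree (ht.subgroup K),
    hu.isLeftGoldie_of_isLeftGoldie hg⟩

/-- The inclusion `k * L → k * H → k * G` for `L ≤ H ≤ G`, up to the isomorphism of `L` with its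
copy in `H`. -/
theorem exists_restrict_ringEquiv {G : Type*} [Group G] (d : CrossedSystem k G) {H L : Subgroup G}
    (hL : L ≤ H) : ∃ σ : CrossedProduct ((d.restrict H).restrict (L.subgroupOf H)) ≃+*
      CrossedProduct (d.restrict L),
      ∀ x, incl d L (σ x) = incl d H (incl (d.restrict H) (L.subgroupOf H) x) := by
  let e := Subgroup.subgroupOfEquivOfLe hL
  let f : CrossedProduct ((d.restrict H).restrict (L.subgroupOf H)) →+*
    CrossedProduct (d.restrict L) := CrossedProduct.map (d.restrict L) e.toMonoidHom
  have hf : ∀ x, incl d L (f x) = incl d H (incl (d.restrict H) (L.subgroupOf H) x) := fun x => by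
    ext1
    change Finsupp.mapDomain _ (Finsupp.mapDomain _ _) = Finsupp.mapDomain _ (Finsupp.mapDomain _ _)
    rw [← Finsupp.mapDomain_comp, ← Finsupp.mapDomain_comp]
    rfl
  refine ⟨RingEquiv.ofBijective f ⟨fun x y h => ?_, fun x => ?_⟩, hf⟩
  · refine incl_injective _ _ (incl_injective _ _ ?_)
    rw [← hf, ← hf, h]
  · refine ⟨⟨Finsupp.mapDomain e.symm x.coeff⟩, ?_⟩
    ext1
    change Finsupp.mapDomain e (Finsupp.mapDomain e.symm x.coeff) = x.coeff
    rw [← Finsupp.mapDomain_comp]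
    convert Finsupp.mapDomain_id
    ext y
    simp

/-- The restriction formula for `L` in `H`, combined with `[G:L] = [H:L] [G:H]`. -/
theorem virtualOreDim_eq_of_le {G : Type*} [Group G] (d : CrossedSystem k G) {H L : Subgroup G}
    (hL : L ≤ H) [L.Normal] [L.FiniteIndex] (hH : deltaPlus H = ⊥)
    (hg : IsLeftGoldie (CrossedProduct (d.restrict H))) (M : Type*) [AddCommGroup M]
    [Module (CrossedProduct d) M] : virtualOreDim d H M = virtualOreDim d L M := by
  have : H.FiniteIndex := Subgroup.finiteIndex_of_le hL
  obtain ⟨hp', hp, hK⟩ := isPrimeRing_and_isLeftGoldie (d.restrict H) (L.subgroupOf H) hH hg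
  obtain ⟨σ, hσ⟩ := exists_restrict_ringEquiv d hL
  rw [virtualOreDim, virtualOreDim]
  let : Module (CrossedProduct (d.restrict H)) M := Module.compHom M (incl d H)
  have h1 := oreDimRes_div_index (d.restrict H) (L.subgroupOf H) hp hK hp' M
  have h2 : oreDimRes (incl (d.restrict H) (L.subgroupOf H)) M = oreDimRes (incl d L) M := by
    let : Module (CrossedProduct ((d.restrict H).restrict (L.subgroupOf H))) M :=
      Module.compHom M (incl (d.restrict H) (L.subgroupOf H))
    let : Module (CrossedProduct (d.restrict L)) M := Module.compHom M (incl d L)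
    refine oreDim_congr σ M (fun a n => ?_) hp hK
    change incl d H (incl (d.restrict H) (L.subgroupOf H) a) • n = incl d L (σ a) • n
    rw [hσ]
  rw [show oreDimRes (incl d H) M = oreDim (CrossedProduct (d.restrict H)) M from rfl, ← h1, h2,
    ← Subgroup.relIndex_mul_index hL, div_eq_mul_inv, div_eq_mul_inv, mul_assoc, Nat.cast_mul,
    ← ENNReal.mul_inv (Or.inr (ENNReal.natCast_ne_top _)) (Or.inl (ENNReal.natCast_ne_top _)),
    ← div_eq_mul_inv]
  rfl

end Main

theorem mainTheorem7 (k : Type u) [DivisionRing k] :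
    -- Restriction formula: `K ⊴ H` of finite index, `k * K` prime left Goldie, `k * H` prime.
    (∀ (H : Type v) [Group H] (d : CrossedSystem k H) (K : Subgroup H),
      K.Normal → K.FiniteIndex →
      IsPrimeRing (CrossedProduct (d.restrict K)) →
      IsLeftGoldie (CrossedProduct (d.restrict K)) →
      IsPrimeRing (CrossedProduct d) →
      IsLeftGoldie (CrossedProduct d) ∧
      -- `S⁻¹(k * H) ≅ T⁻¹(k * H)` over `k * H`, where `S`, `T` are the sets of non-zero-divisors
      -- of `k * K` and of `k * H`
      (∃ (_ : OreLocalization.OreSet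
            ((CrossedProduct (d.restrict K))⁰.map (CrossedProduct.incl d K)))
          (_ : OreLocalization.OreSet (CrossedProduct d)⁰)
          (θ : OreLocalization ((CrossedProduct (d.restrict K))⁰.map (CrossedProduct.incl d K))
              (CrossedProduct d) ≃+*
            OreLocalization (CrossedProduct d)⁰ (CrossedProduct d)),
          ∀ x : CrossedProduct d,
            θ (OreLocalization.numeratorHom x) = OreLocalization.numeratorHom x) ∧
      ∀ (N : Type w) [AddCommGroup N] [Module (CrossedProduct d) N],
        oreDimRes (CrossedProduct.incl d K) N / (K.index : ℝ≥0∞) = oreDim (CrossedProduct d) N) ∧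
    -- The previous hypotheses hold if `Δ⁺(H) = 1` and `k * H` is left Goldie.
    (∀ (H : Type v) [Group H] (d : CrossedSystem k H) (K : Subgroup H),
      K.Normal → K.FiniteIndex → deltaPlus H = ⊥ → IsLeftGoldie (CrossedProduct d) →
      IsPrimeRing (CrossedProduct d) ∧
      IsPrimeRing (CrossedProduct (d.restrict K)) ∧
      IsLeftGoldie (CrossedProduct (d.restrict K)) ∧
      ∀ (N : Type w) [AddCommGroup N] [Module (CrossedProduct d) N],
        oreDimRes (CrossedProduct.incl d K) N / (K.index : ℝ≥0∞) = oreDim (CrossedProduct d) N) ∧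
    -- The virtual Ore dimension is independent of the finite-index subgroup.
    (∀ (G : Type v) [Group G] (d : CrossedSystem k G) (H H' : Subgroup G),
      H.FiniteIndex → H'.FiniteIndex → deltaPlus H = ⊥ → deltaPlus H' = ⊥ →
      IsLeftGoldie (CrossedProduct (d.restrict H)) →
      IsLeftGoldie (CrossedProduct (d.restrict H')) →
      ∀ (M : Type w) [AddCommGroup M] [Module (CrossedProduct d) M],
        virtualOreDim d H M = virtualOreDim d H' M) := by
  refine ⟨fun H _ d K _ _ hp hK hp' => ?_, fun H _ d K _ _ hΔ hg => ?_,
    fun G _ d H H' _ _ hΔ hΔ' hg hg' M _ _ => ?_⟩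
  · have : Fintype (H ⧸ K) := Fintype.ofFinite _
    obtain ⟨u, hu⟩ := CrossedProduct.exists_isNormalizingBasis d K
    exact ⟨hu.isLeftGoldie hp hK, hu.exists_ringEquiv hp hK,
      fun N _ _ => oreDimRes_div_index d K hp hK hp' N⟩
  · obtain ⟨hp', hp, hK⟩ := isPrimeRing_and_isLeftGoldie d K hΔ hg
    exact ⟨hp', hp, hK, fun N _ _ => oreDimRes_div_index d K hp hK hp' N⟩
  -- The normal core has finite index and is normal in both `H` and `H'`, so it serves as the common
  -- subgroup for comparison.
  · have hL : (H ⊓ H').normalCore ≤ H ⊓ H' := Subgroup.normalCore_le _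
    rw [virtualOreDim_eq_of_le d (hL.trans inf_le_left) hΔ hg M,
      virtualOreDim_eq_of_le d (hL.trans inf_le_right) hΔ' hg' M]
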